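/- Identify $\mathbb S^3$ with the unit quaternions in $\mathbb H=\mathbb R^4$, and write $\alpha\times\beta=\tfrac12(\alpha\beta-\beta\alpha)$ for the cross product of imaginary quaternions. Equip $\mathbb S^3\times\mathbb S^3$ with the nearly Kähler structure $$J(X,Y)_{(x,y)}=\tfrac1{\sqrt3}\bigl(2xy^{-1}Y-X,\,-2yx^{-1}X+Y\bigr),\qquad g(Z,Z')=\tfrac12\bigl(\langle Z,Z'\rangle+\langle JZ,JZ'\rangle\bigr),$$ where $\langle\cdot,\cdot\rangle$ is the Euclidean product metric. An immersion of a 3-manifold into $\mathbb S^3\times\mathbb S^3$ is Lagrangian if $J$ maps each tangent vector of the immersion to a $g$-normal vector. **Theorem.** Let $U\subseteq\mathbb C$ be open and simply connected (in particular connected and non-empty), with coordinate $z=u+Iv$, and let $\omega:U\to\mathbb R$ be a smooth solution of the sinh-Gordon equation $\Delta\omega=-8\sinh\omega$. Then there is an associated minimal surface, i.e. a smooth minimal immersion $p:U\to\mathbb S^3$ with $\langle p_u,p_u\rangle=\langle p_v,p_v\rangle=2e^{\omega}$, $\langle p_u,p_v\rangle=0$ and $\sigma(\partial z,\partial z)=-1$.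 Here $\alpha_2=\bar p\,p_u$, $\alpha_3=\bar p\,p_v$, $\partial z=\frac12(\partial u-I\partial v)$, and $\sigma$ is the second fundamental form, extended complex bilinearly, in the direction of the unit normal $N=p\,\frac{\alpha_2\times\alpha_3}{|\alpha_2\times\alpha_3|}$. Moreover, for every such $p$: 1. For all $z_0\in U$, $t_0\in\mathbb R$, $q_0\in\mathbb S^3$ there is exactly one smooth $q:U\times\mathbb R\to\mathbb S^3$ with $q(z_0,t_0)=q_0$ and $$\begin{aligned} \frac{\partial q}{\partial t}&=-\frac{\sqrt3e^{-\omega}}4\,q\,(\alpha_2\times\alpha_3),\\ \frac{\partial q}{\partial u}&=\frac{e^{-\omega}}8\bigl(4e^{\omega}q\alpha_2-4q\alpha_3+\omega_v\,q\,(\alpha_2\times\alpha_3)\bigr),\\ \frac{\partial q}{\partial v}&=-\frac{e^{-\omega}}8\bigl(4q\alpha_2-4e^{\omega}q\alpha_3+\omega_u\,q\,(\alpha_2\times\alpha_3)\bigr). \end{aligned}$$ 2. For every smooth solution $q:U\times\mathbb R\to\mathbb S^3$ of this system, $f:U\times\mathbb R\to\mathbb S^3\times\mathbb S^3$, $f(z,t)=(p(z),q(z,t))$,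 is a Lagrangian immersion. 3. If $\omega=0$ on $U$ (so that $p$ is part of a Clifford torus), then for every such $q$ there are unit quaternions $a,b,c$ such that $$f(u+Iv,t)=\Phi\Bigl(F\bigl(u-v,\,-\tfrac{\sqrt3}2t,\,u+v\bigr)\Bigr)\quad\text{on }U\times\mathbb R,$$ where $\Phi(x,y)=(axc^{-1},byc^{-1})$ is an isometry of $(\mathbb S^3\times\mathbb S^3,g)$ and $F$ is the flat Lagrangian torus $F(u,v,w)=(P(u,w),Q(u,v))$ with $$\begin{aligned} P(u,w)&=(\cos u\cos w,\cos u\sin w,\sin u\cos w,\sin u\sin w),\\ Q(u,v)&=\tfrac1{\sqrt2}\bigl(\cos v(\sin u+\cos u),\sin v(\sin u+\cos u),\cos v(\sin u-\cos u),\sin v(\sin u-\cos u)\bigr). \end{aligned}$$ -/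

import Mathlib

open scoped Quaternion

noncomputable section

namespace NKS3

/-- The cross product of imaginary quaternions, `α × β = (αβ - βα) / 2`. -/
def cross (a b : ℍ[ℝ]) : ℍ[ℝ] := (1 / 2 : ℝ) • (a * b - b * a)

/-! The nearly Kähler structure of `S³ × S³`, with `S³` the unit quaternions. A point is a pair
`x = (p, q)` of unit quaternions and a tangent vector at `x` is a pair `Z = (U, V)` of quaternions
with `U ⊥ p` and `V ⊥ q`. -/

/-- The almost complex structure
`J (U, V) = (2 p q⁻¹ V - U, -2 q p⁻¹ U + V) / √3` at `x = (p, q)`. -/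
def J (x Z : ℍ[ℝ] × ℍ[ℝ]) : ℍ[ℝ] × ℍ[ℝ] :=
  (1 / √3 : ℝ) •
    ((2 : ℝ) • (x.1 * x.2⁻¹ * Z.2) - Z.1, -((2 : ℝ) • (x.2 * x.1⁻¹ * Z.1)) + Z.2)

/-- The Euclidean product metric on `ℍ × ℍ = ℝ⁸`. -/
def euclid (Z W : ℍ[ℝ] × ℍ[ℝ]) : ℝ := inner ℝ Z.1 W.1 + inner ℝ Z.2 W.2

/-- The nearly Kähler metric `g (Z, W) = (⟨Z, W⟩ + ⟨J Z, J W⟩) / 2` at `x`. -/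
def g (x Z W : ℍ[ℝ] × ℍ[ℝ]) : ℝ := (1 / 2) * (euclid Z W + euclid (J x Z) (J x W))

/-- `f` is a (smooth) Lagrangian immersion of the open subset `D` of the three-dimensional space
`ℂ × ℝ` into the nearly Kähler `S³ × S³`: its differential is injective, and `J` maps every vector
tangent to the immersion to a vector that is `g`-normal to the immersion. -/
structure IsLagrangianImmersion (D : Set (ℂ × ℝ)) (f : ℂ × ℝ → ℍ[ℝ] × ℍ[ℝ]) : Prop where
  smooth : ContDiffOn ℝ (⊤ : ℕ∞) f D
  mem_sphere : ∀ x ∈ D, ‖(f x).1‖ = 1 ∧ ‖(f x).2‖ = 1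
  immersion : ∀ x ∈ D, Function.Injective (fderiv ℝ f x)
  lagrangian : ∀ x ∈ D, ∀ X Y : ℂ × ℝ,
    g (f x) (J (f x) (fderiv ℝ f x X)) (fderiv ℝ f x Y) = 0

/-! Surfaces in `S³`, in the coordinate `z = u + I v`. -/

section Surface

variable {E : Type*} [NormedAddCommGroup E] [NormedSpace ℝ E]

/-- The partial derivative `∂h/∂u`. -/
def du (h : ℂ → E) (z : ℂ) : E := fderiv ℝ h z 1

/-- The partial derivative `∂h/∂v`. -/
def dv (h : ℂ → E) (z : ℂ) : E := fderiv ℝ h z Complex.I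

end Surface

/-- `α₂ = p̄ p_u`. -/
def alpha2 (p : ℂ → ℍ[ℝ]) (z : ℂ) : ℍ[ℝ] := star (p z) * du p z

/-- `α₃ = p̄ p_v`. -/
def alpha3 (p : ℂ → ℍ[ℝ]) (z : ℂ) : ℍ[ℝ] := star (p z) * dv p z

/-- The unit normal in `S³`, `N = p (α₂ × α₃) / |α₂ × α₃|`. -/
def unitNormal (p : ℂ → ℍ[ℝ]) (z : ℂ) : ℍ[ℝ] :=
  ‖cross (alpha2 p z) (alpha3 p z)‖⁻¹ • (p z * cross (alpha2 p z) (alpha3 p z))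

/-- The second fundamental form `σ(x, y)` of `p` in the direction of `N`, on the tangent vectors
with coordinates `x, y ∈ ℂ = ℝ²`. -/
def sff (p : ℂ → ℍ[ℝ]) (z x y : ℂ) : ℝ :=
  inner ℝ (fderiv ℝ (fun w => fderiv ℝ p w x) z y) (unitNormal p z)

/-- The complex bilinear extension of `σ`; the pair `X = (X.1, X.2)` stands for the complexified
tangent vector `X.1 + I X.2`. -/
def sffC (p : ℂ → ℍ[ℝ]) (z : ℂ) (X Y : ℂ × ℂ) : ℂ :=
  ((sff p z X.1 Y.1 - sff p z X.2 Y.2 : ℝ) : ℂ)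
    + Complex.I * ((sff p z X.1 Y.2 + sff p z X.2 Y.1 : ℝ) : ℂ)

/-- The complexified tangent vector `∂z = (∂u - I ∂v) / 2`. -/
def partialZ : ℂ × ℂ := (1 / 2, -(Complex.I / 2))

/-- `ω` is a (smooth) solution of the sinh-Gordon equation `Δω = -8 sinh ω` on `U`. -/
def IsSinhGordonSolution (U : Set ℂ) (ω : ℂ → ℝ) : Prop :=
  ContDiffOn ℝ (⊤ : ℕ∞) ω U ∧ ∀ z ∈ U, Laplacian.laplacian ω z = -8 * Real.sinh (ω z)

/-- `p : U → S³` is a minimal surface associated with `ω`: the coordinates `u, v` are isothermal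
with `⟨∂u, ∂u⟩ = ⟨∂v, ∂v⟩ = 2 e^ω`, the trace of the second fundamental form with respect to the
induced metric vanishes, and `σ(∂z, ∂z) = -1`. -/
structure IsAssociatedMinimalSurface (U : Set ℂ) (ω : ℂ → ℝ) (p : ℂ → ℍ[ℝ]) : Prop where
  smooth : ContDiffOn ℝ (⊤ : ℕ∞) p U
  mem_sphere : ∀ z ∈ U, ‖p z‖ = 1
  inner_uu : ∀ z ∈ U, inner ℝ (du p z) (du p z) = 2 * Real.exp (ω z)
  inner_vv : ∀ z ∈ U, inner ℝ (dv p z) (dv p z) = 2 * Real.exp (ω z)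
  inner_uv : ∀ z ∈ U, inner ℝ (du p z) (dv p z) = 0
  minimal : ∀ z ∈ U, ∀ x y : ℂ, ‖fderiv ℝ p z x‖ = 1 → ‖fderiv ℝ p z y‖ = 1 →
    inner ℝ (fderiv ℝ p z x) (fderiv ℝ p z y) = 0 → sff p z x x + sff p z y y = 0
  hopf : ∀ z ∈ U, sffC p z partialZ partialZ = -1

/-- `q : U × ℝ → S³` is a (smooth) solution of the system
`q_t = -(√3 e^{-ω} / 4) q (α₂ × α₃)`,
`q_u = (e^{-ω} / 8) (4 e^ω q α₂ - 4 q α₃ + ω_v q (α₂ × α₃))`,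
`q_v = -(e^{-ω} / 8) (4 q α₂ - 4 e^ω q α₃ + ω_u q (α₂ × α₃))`. -/
structure IsSecondComponent (U : Set ℂ) (ω : ℂ → ℝ) (p : ℂ → ℍ[ℝ]) (q : ℂ × ℝ → ℍ[ℝ]) :
    Prop where
  smooth : ContDiffOn ℝ (⊤ : ℕ∞) q (U ×ˢ Set.univ)
  mem_sphere : ∀ z ∈ U, ∀ t : ℝ, ‖q (z, t)‖ = 1
  dq_t : ∀ z ∈ U, ∀ t : ℝ, fderiv ℝ q (z, t) (0, 1) =
    -((√3 * Real.exp (-ω z) / 4) • (q (z, t) * cross (alpha2 p z) (alpha3 p z)))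
  dq_u : ∀ z ∈ U, ∀ t : ℝ, fderiv ℝ q (z, t) (1, 0) =
    (Real.exp (-ω z) / 8) •
      ((4 * Real.exp (ω z)) • (q (z, t) * alpha2 p z) - (4 : ℝ) • (q (z, t) * alpha3 p z)
        + dv ω z • (q (z, t) * cross (alpha2 p z) (alpha3 p z)))
  dq_v : ∀ z ∈ U, ∀ t : ℝ, fderiv ℝ q (z, t) (Complex.I, 0) =
    -((Real.exp (-ω z) / 8) •
      ((4 : ℝ) • (q (z, t) * alpha2 p z) - (4 * Real.exp (ω z)) • (q (z, t) * alpha3 p z)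
        + du ω z • (q (z, t) * cross (alpha2 p z) (alpha3 p z))))

/-- First component of the flat Lagrangian torus, a parametrization of the Clifford torus. -/
def flatTorusP (u w : ℝ) : ℍ[ℝ] :=
  ⟨Real.cos u * Real.cos w, Real.cos u * Real.sin w,
    Real.sin u * Real.cos w, Real.sin u * Real.sin w⟩

/-- Second component of the flat Lagrangian torus. -/
def flatTorusQ (u v : ℝ) : ℍ[ℝ] :=
  (1 / √2 : ℝ) • (⟨Real.cos v * (Real.sin u + Real.cos u), Real.sin v * (Real.sin u + Real.cos u),
    Real.cos v * (Real.sin u - Real.cos u), Real.sin v * (Real.sin u - Real.cos u)⟩ : ℍ[ℝ])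

/-- The flat Lagrangian torus `(u, v, w) ↦ (p(u, w), q(u, v))` in `S³ × S³`. -/
def flatTorus (u v w : ℝ) : ℍ[ℝ] × ℍ[ℝ] := (flatTorusP u w, flatTorusQ u v)

/-- The isometry `(x, y) ↦ (a x c⁻¹, b y c⁻¹)` of the nearly Kähler `S³ × S³` given by three unit
quaternions `a, b, c`. -/
def isometry (a b c : ℍ[ℝ]) (x : ℍ[ℝ] × ℍ[ℝ]) : ℍ[ℝ] × ℍ[ℝ] := (a * x.1 * c⁻¹, b * x.2 * c⁻¹)

end NKS3

end

/-!
The proof works throughout with left translations: a map `F` into the unit quaternions is described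
by its logarithmic derivative `A = F⁻¹ dF`, a one-form with imaginary quaternions as values, and all
the maps to be constructed or compared are solutions of a system `dF = F A`.

*Integration.* If `A` is flat, i.e. `dA + A ∧ A = 0`, then `dF = F A` is solvable near each point,
by integration along rays (`exists_local_solution`). Two solutions with imaginary `A` differ by a
constant left factor (`mul_star_eq_of_solutions`), so the germs of solutions form a covering space
(`solutionBundle`), and over a simply connected domain this has a section through any given germ
(`exists_global_solution`).

*The minimal surface.* The sinh-Gordon equation is the flatness condition of a Lax pair with a sign
`ε = ±1` (`lax_flat`). If `F₊` and `F₋` are solutions for the two signs, then `p = F₊ F₋⁻¹` is an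
associated minimal surface (`isAssociatedMinimalSurface_of_frame`).

*The second component.* For any associated minimal surface, trace and Hopf differential determine
the second fundamental form (`sff_values`), and so the derivatives of `α₂` and `α₃` are known
(`second_derivatives`). With these the `(u, v)`-part of the system for `q` is seen to be flat
(`second_flat`), again by the sinh-Gordon equation, and the left-translated normal `n = p⁻¹ N` to be
parallel for it (`du_leftNormal`, `dv_leftNormal`). As `n² = -1` and `q⁻¹ q_t = -(√3 / 2) n`, a
solution of the `(u, v)`-part is continued to all times by the right factor `cos θ - n sin θ` with
`θ = (√3 / 2) (t - t₀)` (`exists_isSecondComponent`).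

*The Lagrangian condition.* In the left trivialization the Kähler form is
`g (J (X, Y), (X', Y')) = 2 / √3 (⟨Y, X'⟩ - ⟨X, Y'⟩)` (`g_J_mul`); it vanishes on the tangent spaces
because `⟨q⁻¹ dq, p⁻¹ dp⟩` is a symmetric bilinear form (`inner_secondForm_symm`).

*The flat case.* Both components of the flat torus have the form `e^{iV} e^{jW}`. For `ω = 0` the
frame `α₂, α₃, α₂ × α₃` satisfies a linear system with constant coefficients, the same for all `p`,
so it is the frame of the flat torus up to a conjugation by a constant `c` (`exists_conj_frame`). The
one-forms of both components are then conjugate by `c` to the ones of the flat torus, and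
`exists_eq_mul_mul_inv` gives the congruence.
-/

noncomputable section

namespace NKS3

open Set Metric Filter Topology

/-! ### Local solutions of flat systems -/

section Local

open Asymptotics

variable {E 𝔸 : Type*} [NormedAddCommGroup E] [NormedSpace ℝ E]
  [NormedRing 𝔸] [NormedAlgebra ℝ 𝔸]

/-- The differential of a solution `F` of the total differential equation `dF = F A`, with `A` a
one-form with values in the algebra `𝔸`: the linear map `h ↦ F (A h)`. -/
def leftMulForm (F : 𝔸) (A : E →L[ℝ] 𝔸) : E →L[ℝ] 𝔸 := (ContinuousLinearMap.mul ℝ 𝔸 F).comp A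

@[simp] lemma leftMulForm_apply (F : 𝔸) (A : E →L[ℝ] 𝔸) (h : E) : leftMulForm F A h = F * A h := rfl

/-- The second order Taylor estimate on a convex set on which the derivative is Lipschitz. -/
lemma norm_taylor_le {V : Type*} [NormedAddCommGroup V] [NormedSpace ℝ V] {s : Set E}
    (hs : Convex ℝ s) {f : E → V} {f' : E → E →L[ℝ] V} (hf : ∀ x ∈ s, HasFDerivAt f (f' x) x)
    {L : ℝ} (hL0 : 0 ≤ L) (hL : ∀ x ∈ s, ∀ y ∈ s, ‖f' y - f' x‖ ≤ L * ‖y - x‖)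
    {x y : E} (hx : x ∈ s) (hy : y ∈ s) :
    ‖f y - f x - f' x (y - x)‖ ≤ L * ‖y - x‖ ^ 2 := by
  have hseg : segment ℝ x y ⊆ s := hs.segment_subset hx hy
  have h := (convex_segment x y).norm_image_sub_le_of_norm_hasFDerivWithin_le'
    (f := f) (f' := f') (φ := f' x) (C := L * ‖y - x‖)
    (fun z hz => (hf z (hseg hz)).hasFDerivWithinAt)
    (fun z hz => by
      refine (hL x hx z (hseg hz)).trans ?_
      gcongr
      obtain ⟨θ, hθ, rfl⟩ := (segment_eq_image' ℝ x y ▸ hz)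
      rw [add_sub_cancel_left, norm_smul, Real.norm_of_nonneg hθ.1]
      exact mul_le_of_le_one_left (norm_nonneg _) hθ.2)
    (left_mem_segment ℝ x y) (right_mem_segment ℝ x y)
  simpa [pow_two, mul_assoc] using h

/-- A linear differential equation `G' = G B` with small continuous coefficient has a solution on
`[0, 1]` starting from `1`. -/
lemma exists_linear_ode [CompleteSpace 𝔸] [NormOneClass 𝔸] {B : ℝ → 𝔸}
    (hB : ContinuousOn B (Icc 0 1))
    (hb : ∀ t ∈ Icc (0 : ℝ) 1, ‖B t‖ ≤ 1 / 2) :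
    ∃ G : ℝ → 𝔸, G 0 = 1 ∧ ∀ t ∈ Icc (0 : ℝ) 1, HasDerivWithinAt G (G t * B t) (Icc 0 1) t := by
  have hpl : IsPicardLindelof (fun t x => x * B t) (tmin := 0) (tmax := 1)
      ⟨0, by simp⟩ (1 : 𝔸) 1 0 1 1 := by
    refine ⟨fun t ht => ?_, fun x _ => continuousOn_const.mul hB, fun t ht x hx => ?_, by simp⟩
    · refine LipschitzOnWith.of_dist_le_mul fun x _ y _ => ?_
      rw [dist_eq_norm, dist_eq_norm, ← sub_mul]
      refine (norm_mul_le _ _).trans ?_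
      rw [mul_comm]
      gcongr
      exact (hb t ht).trans (by norm_num)
    · have : ‖x‖ ≤ 2 := by
        have := norm_le_norm_add_norm_sub' x 1
        rw [mem_closedBall, dist_eq_norm] at hx
        rw [norm_one] at this
        have h1 : ((1 : NNReal) : ℝ) = 1 := rfl
        linarith
      calc ‖x * B t‖ ≤ ‖x‖ * ‖B t‖ := norm_mul_le _ _
        _ ≤ 2 * (1 / 2) := by gcongr; exact hb t ht
        _ = ((1 : NNReal) : ℝ) := by norm_num
  exact hpl.exists_eq_forall_mem_Icc_hasDerivWithinAt₀

/-- Local solvability of `dF = F A` for a flat one-form `A`. The solution is obtained by integrating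
along rays from `z₀`; flatness enters in the proof that the resulting function is differentiable in
all directions: the difference between the ray solutions towards `h + k` and `h` and its expected
linearization satisfies a linear differential equation with a forcing term of order `‖k‖²`, so that
Grönwall's inequality applies. -/
theorem exists_local_solution [CompleteSpace 𝔸] [NormOneClass 𝔸] {U : Set E} (hU : IsOpen U)
    {A : E → E →L[ℝ] 𝔸} (hA : ContDiffOn ℝ 2 A U)
    (hflat : ∀ z ∈ U, ∀ h k : E,
      A z k * A z h + fderiv ℝ A z k h = A z h * A z k + fderiv ℝ A z h k)
    {z₀ : E} (hz₀ : z₀ ∈ U) :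
    ∃ r > 0, ball z₀ r ⊆ U ∧ ∃ F : E → 𝔸, F z₀ = 1 ∧
      ∀ z ∈ ball z₀ r, HasFDerivAt F (leftMulForm (F z) (A z)) z := by
  have hUn : U ∈ 𝓝 z₀ := hU.mem_nhds hz₀
  have hd : ∀ z ∈ U, HasFDerivAt A (fderiv ℝ A z) z := fun z hz =>
    ((hA.contDiffAt (hU.mem_nhds hz)).differentiableAt (by norm_num)).hasFDerivAt
  have hA' : ContDiffAt ℝ 1 (fderiv ℝ A) z₀ :=
    (hA.contDiffAt hUn).fderiv_right (by norm_num)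
  obtain ⟨K₁, s₁, hs₁, hK₁⟩ := hA'.exists_lipschitzOnWith
  obtain ⟨K₂, s₂, hs₂, hK₂⟩ :=
    ((hA.contDiffAt hUn).of_le (by norm_num : (1 : WithTop ℕ∞) ≤ 2)).exists_lipschitzOnWith
  -- `M` bounds `A` near `z₀`; the radius `r` is so small that the ray equation has a coefficient
  -- of norm at most `M r ≤ 1 / 2`, so that its solution exists up to time `1`
  set M : ℝ := ‖A z₀‖ + 1
  have hMev : ∀ᶠ z in 𝓝 z₀, ‖A z‖ < M :=
    (hA.contDiffAt hUn).continuousAt.norm.eventually_lt_const (by simp [M])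
  obtain ⟨R, hR, hRs⟩ := Metric.mem_nhds_iff.1
    (inter_mem (inter_mem hUn hMev) (inter_mem hs₁ hs₂))
  have hM : 1 ≤ M := by simp [M]
  set r : ℝ := min R (1 / (2 * M))
  have hr : 0 < r := by positivity
  have hrR : ball z₀ r ⊆ ball z₀ R := ball_subset_ball (min_le_left _ _)
  have hrM : M * r ≤ 1 / 2 := by
    calc M * r ≤ M * (1 / (2 * M)) := by gcongr; exact min_le_right _ _
      _ = 1 / 2 := by field_simp
  have hr1 : r ≤ 1 := by nlinarith
  have hBU : ∀ z ∈ ball z₀ r, z ∈ U := fun z hz => (hRs (hrR hz)).1.1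
  have hBM : ∀ z ∈ ball z₀ r, ‖A z‖ ≤ M := fun z hz => le_of_lt (hRs (hrR hz)).1.2
  have hL₁ : ∀ x ∈ ball z₀ r, ∀ y ∈ ball z₀ r,
      ‖fderiv ℝ A y - fderiv ℝ A x‖ ≤ K₁ * ‖y - x‖ := fun x hx y hy => by
    simpa [dist_eq_norm] using hK₁.dist_le_mul y (hRs (hrR hy)).2.1 x (hRs (hrR hx)).2.1
  have hL₂ : ∀ x ∈ ball z₀ r, ∀ y ∈ ball z₀ r, ‖A y - A x‖ ≤ K₂ * ‖y - x‖ := fun x hx y hy => by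
    simpa [dist_eq_norm] using hK₂.dist_le_mul y (hRs (hrR hy)).2.2 x (hRs (hrR hx)).2.2
  have hT : ∀ x ∈ ball z₀ r, ∀ y ∈ ball z₀ r,
      ‖A y - A x - fderiv ℝ A x (y - x)‖ ≤ K₁ * ‖y - x‖ ^ 2 := fun x hx y hy =>
    norm_taylor_le (convex_ball z₀ r) (fun z hz => hd z (hBU z hz)) K₁.2 hL₁ hx hy
  -- points on the ray towards `z₀ + h`
  have hray : ∀ h : E, ‖h‖ < r → ∀ t ∈ Icc (0 : ℝ) 1, z₀ + t • h ∈ ball z₀ r := by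
    intro h hh t ht
    rw [mem_ball, dist_eq_norm, add_sub_cancel_left, norm_smul, Real.norm_of_nonneg ht.1]
    exact (mul_le_of_le_one_left (norm_nonneg _) ht.2).trans_lt hh
  have hrayd : ∀ h : E, ∀ t : ℝ, HasDerivAt (fun t : ℝ => z₀ + t • h) h t := by
    intro h t
    simpa using ((hasDerivAt_id t).smul_const h).const_add z₀
  have hAray : ∀ h : E, ‖h‖ < r → ∀ t ∈ Icc (0 : ℝ) 1,
      HasDerivAt (fun t : ℝ => A (z₀ + t • h)) (fderiv ℝ A (z₀ + t • h) h) t := fun h hh t ht =>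
    (hd _ (hBU _ (hray h hh t ht))).comp_hasDerivAt t (hrayd h t)
  have hsol : ∀ h : E, ‖h‖ < r → ∃ G : ℝ → 𝔸, G 0 = 1 ∧ ∀ t ∈ Icc (0 : ℝ) 1,
      HasDerivWithinAt G (G t * A (z₀ + t • h) h) (Icc 0 1) t := by
    intro h hh
    refine exists_linear_ode (fun t ht => ?_) fun t ht => ?_
    · exact ((hAray h hh t ht).clm_apply (hasDerivAt_const t h)).continuousAt.continuousWithinAt
    · calc _ ≤ ‖A (z₀ + t • h)‖ * ‖h‖ := (A _).le_opNorm h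
        _ ≤ M * r := by gcongr; exact hBM _ (hray h hh t ht)
        _ ≤ 1 / 2 := hrM
  choose! G hG0 hG using hsol
  -- the solution along the constant ray is constant
  have hG00 : G 0 1 = 1 := by
    have h0 : ‖(0 : E)‖ < r := by simpa using hr
    have := constant_of_has_deriv_right_zero (f := G 0) (a := 0) (b := 1)
      (fun t ht => (hG 0 h0 t ht).continuousWithinAt) (fun t ht => by
        have : HasDerivWithinAt (G 0) _ (Ici t) t :=
          (hG 0 h0 t (Ico_subset_Icc_self ht)).mono_of_mem_nhdsWithin (Icc_mem_nhdsGE_of_mem ht)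
        simpa using this) 1 (by simp)
    rw [this, hG0 0 h0]
  refine ⟨r, hr, hBU, fun z => G (z - z₀) 1, by simpa using hG00, fun z hz => ?_⟩
  obtain ⟨h, rfl⟩ : ∃ h, z = z₀ + h := ⟨z - z₀, by abel⟩
  have hh : ‖h‖ < r := by simpa [dist_eq_norm] using hz
  simp only [add_sub_cancel_left]
  have hGc : ContinuousOn (G h) (Icc 0 1) := fun t ht => (hG h hh t ht).continuousWithinAt
  obtain ⟨C, hC⟩ := isCompact_Icc.exists_bound_of_continuousOn hGc
  have hC0 : 0 ≤ C := (norm_nonneg _).trans (hC 0 (by simp))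
  -- the forcing term of the equation for `D` below is at most `C₁ ‖k‖²`
  set C₁ : ℝ := C * (K₁ + K₂ + M * (K₂ + M))
  have hC₁ : 0 ≤ C₁ := by positivity
  rw [hasFDerivAt_iff_isLittleO_nhds_zero]
  have hbig : (fun k : E => G (z₀ + h + k - z₀) 1 - G h 1 - leftMulForm (G h 1) (A (z₀ + h)) k)
      =O[𝓝 0] fun k : E => ‖k‖ ^ 2 := by
    refine IsBigO.of_bound (C₁ * Real.exp 1) ?_
    have hev : ∀ᶠ k : E in 𝓝 0, ‖k‖ < r - ‖h‖ := by
      have := ball_mem_nhds (0 : E) (sub_pos.2 hh)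
      filter_upwards [this] with k hk
      simpa using hk
    filter_upwards [hev] with k hk
    have hhk : ‖h + k‖ < r := (norm_add_le _ _).trans_lt (by linarith)
    have e1 : z₀ + h + k - z₀ = h + k := by abel
    rw [e1, norm_pow, norm_norm]
    -- the error of the linearization of `G` at `h`, along the ray
    set D : ℝ → 𝔸 := fun t => G (h + k) t - G h t - G h t * A (z₀ + t • h) (t • k)
    -- `G h t * W t` is the forcing term of the equation for `D`
    set W : ℝ → 𝔸 := fun t =>
      (A (z₀ + t • (h + k)) - A (z₀ + t • h) - fderiv ℝ A (z₀ + t • h) (t • k)) h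
        + (A (z₀ + t • (h + k)) - A (z₀ + t • h)) k
        + A (z₀ + t • h) (t • k) *
          ((A (z₀ + t • (h + k)) - A (z₀ + t • h)) (h + k) + A (z₀ + t • h) k)
    have hD : ∀ t ∈ Icc (0 : ℝ) 1, HasDerivWithinAt D
        (D t * A (z₀ + t • (h + k)) (h + k) + G h t * W t) (Icc 0 1) t := by
      intro t ht
      have h1 := hG (h + k) hhk t ht
      have h2 := hG h hh t ht
      have h3 := ((hAray h hh t ht).clm_apply
        (by simpa using (hasDerivAt_id t).smul_const k :
          HasDerivAt (fun t : ℝ => t • k) k t)).hasDerivWithinAt (s := Icc 0 1)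
      convert! (h1.sub h2).sub (h2.mul h3) using 1
      -- flatness exchanges the two directions in the derivative of `A`
      have hf := hflat _ (hBU _ (hray h hh t ht)) h (t • k)
      have hf' : fderiv ℝ A (z₀ + t • h) h (t • k) = A (z₀ + t • h) (t • k) * A (z₀ + t • h) h
          + fderiv ℝ A (z₀ + t • h) (t • k) h - A (z₀ + t • h) h * A (z₀ + t • h) (t • k) := by
        rw [hf]; abel
      rw [hf']
      simp only [D, W, map_add, sub_apply]
      noncomm_ring
    have hW : ∀ t ∈ Icc (0 : ℝ) 1, ‖W t‖ ≤ (K₁ + K₂ + M * (K₂ + M)) * ‖k‖ ^ 2 := by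
      intro t ht
      have hx := hray h hh t ht
      have hy := hray (h + k) hhk t ht
      have e : z₀ + t • (h + k) - (z₀ + t • h) = t • k := by rw [smul_add]; abel
      have htk : ‖t • k‖ ≤ ‖k‖ := by
        rw [norm_smul, Real.norm_of_nonneg ht.1]
        exact mul_le_of_le_one_left (norm_nonneg _) ht.2
      have b1 := hT _ hx _ hy
      have b2 := hL₂ _ hx _ hy
      rw [e] at b1 b2
      have b3 := hBM _ hx
      have hh1 : ‖h‖ ≤ 1 := by linarith
      have hhk1 : ‖h + k‖ ≤ 1 := by linarith
      have c1 : ‖(A (z₀ + t • (h + k)) - A (z₀ + t • h) - fderiv ℝ A (z₀ + t • h) (t • k)) h‖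
          ≤ K₁ * ‖k‖ ^ 2 := by
        calc _ ≤ _ * ‖h‖ := ContinuousLinearMap.le_opNorm _ _
          _ ≤ (K₁ * ‖t • k‖ ^ 2) * 1 := by gcongr
          _ ≤ K₁ * ‖k‖ ^ 2 := by rw [mul_one]; gcongr
      have c2 : ‖A (z₀ + t • (h + k)) - A (z₀ + t • h)‖ ≤ K₂ * ‖k‖ := b2.trans (by gcongr)
      have c3 : ‖(A (z₀ + t • (h + k)) - A (z₀ + t • h)) k‖ ≤ K₂ * ‖k‖ * ‖k‖ :=
        (ContinuousLinearMap.le_opNorm _ _).trans (by gcongr)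
      have c4 : ‖(A (z₀ + t • (h + k)) - A (z₀ + t • h)) (h + k)‖ ≤ K₂ * ‖k‖ * 1 :=
        (ContinuousLinearMap.le_opNorm _ _).trans (by gcongr)
      have c5 : ‖A (z₀ + t • h) k‖ ≤ M * ‖k‖ :=
        (ContinuousLinearMap.le_opNorm _ _).trans (by gcongr)
      have c6 : ‖A (z₀ + t • h) (t • k)‖ ≤ M * ‖k‖ :=
        (ContinuousLinearMap.le_opNorm _ _).trans (by gcongr)
      calc ‖W t‖ ≤ _ := norm_add₃_le
        _ ≤ K₁ * ‖k‖ ^ 2 + K₂ * ‖k‖ * ‖k‖ + M * ‖k‖ * (K₂ * ‖k‖ * 1 + M * ‖k‖) := by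
          gcongr
          refine (norm_mul_le _ _).trans ?_
          gcongr
          exact (norm_add_le _ _).trans (add_le_add c4 c5)
        _ = _ := by ring
    have hgr := norm_le_gronwallBound_of_norm_deriv_right_le (f := D) (δ := 0) (K := 1)
      (ε := C₁ * ‖k‖ ^ 2) (a := 0) (b := 1)
      (fun t ht => (hD t ht).continuousWithinAt)
      (f' := fun t => D t * A (z₀ + t • (h + k)) (h + k) + G h t * W t)
      (fun t ht => (hD t (Ico_subset_Icc_self ht)).mono_of_mem_nhdsWithin
        (Icc_mem_nhdsGE_of_mem ht))
      (by simp [D, hG0 _ hhk, hG0 _ hh])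
      (fun t ht => by
        have ht' := Ico_subset_Icc_self ht
        refine (norm_add_le _ _).trans (add_le_add ?_ ?_)
        · refine (norm_mul_le _ _).trans ?_
          rw [mul_comm]
          gcongr
          calc _ ≤ ‖A (z₀ + t • (h + k))‖ * ‖h + k‖ := ContinuousLinearMap.le_opNorm _ _
            _ ≤ M * r := by gcongr; exact hBM _ (hray _ hhk t ht')
            _ ≤ 1 := by linarith
        · refine (norm_mul_le _ _).trans ?_
          calc _ ≤ C * ((K₁ + K₂ + M * (K₂ + M)) * ‖k‖ ^ 2) := by
                gcongr
                · exact hC t ht'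
                · exact hW t ht'
            _ = C₁ * ‖k‖ ^ 2 := by simp only [C₁]; ring)
      1 (by simp)
    have hD1 : D 1 = G (h + k) 1 - G h 1 - leftMulForm (G h 1) (A (z₀ + h)) k := by
      simp [D]
    rw [hD1] at hgr
    refine hgr.trans ?_
    rw [gronwallBound_of_K_ne_0 one_ne_zero]
    have : 0 ≤ C₁ * ‖k‖ ^ 2 := by positivity
    simp only [zero_mul, div_one, sub_zero, mul_one, zero_add]
    nlinarith
  simpa only [add_sub_cancel_left] using hbig.trans_isLittleO (isLittleO_norm_pow_id one_lt_two)

end Local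

/-! ### Global solutions on simply connected domains -/

section Global

variable {E : Type*} [NormedAddCommGroup E] [NormedSpace ℝ E]

instance : StarModule ℝ ℍ[ℝ] := ⟨fun r q => by simp⟩

lemma mul_star_self_of_norm {q : ℍ[ℝ]} (h : ‖q‖ = 1) : q * star q = 1 := by
  rw [Quaternion.self_mul_star, Quaternion.normSq_eq_norm_mul_self, h]; simp

lemma star_mul_self_of_norm {q : ℍ[ℝ]} (h : ‖q‖ = 1) : star q * q = 1 := by
  rw [Quaternion.star_mul_self, Quaternion.normSq_eq_norm_mul_self, h]; simp

lemma norm_eq_one_of_mul_star {q : ℍ[ℝ]} (h : q * star q = 1) : ‖q‖ = 1 := by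
  have : ‖q * star q‖ = 1 := by rw [h, norm_one]
  rw [norm_mul, norm_star] at this
  nlinarith [norm_nonneg q]

/-- Two solutions of `dF = F A`, with `A` imaginary, differ by a constant factor on the left. -/
lemma mul_star_eq_of_solutions {s : Set E} (hs : IsOpen s) (hc : IsPreconnected s)
    {A : E → E →L[ℝ] ℍ[ℝ]} (hA : ∀ z ∈ s, ∀ h, star (A z h) = -A z h) {F G : E → ℍ[ℝ]}
    (hF : ∀ z ∈ s, HasFDerivAt F (leftMulForm (F z) (A z)) z)
    (hG : ∀ z ∈ s, HasFDerivAt G (leftMulForm (G z) (A z)) z) {x y : E} (hx : x ∈ s) (hy : y ∈ s) :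
    F x * star (G x) = F y * star (G y) := by
  have hd : ∀ z ∈ s, HasFDerivAt (fun z => F z * star (G z)) (0 : E →L[ℝ] ℍ[ℝ]) z := by
    intro z hz
    convert! (hF z hz).mul' (hG z hz).star using 1
    ext1 h
    simp [hA z hz, mul_assoc]
  exact hs.is_const_of_fderiv_eq_zero hc
    (fun z hz => (hd z hz).differentiableAt.differentiableWithinAt)
    (fun z hz => (hd z hz).fderiv) hx hy

/-- A copy of a type, equipped with the discrete topology. -/
def Discrete (X : Type*) : Type _ := X

instance (X : Type*) : TopologicalSpace (Discrete X) := ⊥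

instance (X : Type*) : DiscreteTopology (Discrete X) := ⟨rfl⟩

/-- The bundle of germs of solutions of `dF = F A`, `A` imaginary, built from local solutions
`F i` on the sets `B i`: in the chart `i`, the vector `v` stands for the germ of `v * F i`. Its
fibre is discrete, so that its projection is a covering map. -/
def solutionBundle {X : Type*} [TopologicalSpace X] (B : X → Set X) (F : X → X → ℍ[ℝ])
    (hB : ∀ i, IsOpen (B i)) (hmem : ∀ i, i ∈ B i) (hF : ∀ i, ∀ x ∈ B i, ‖F i x‖ = 1)
    (hc : ∀ i j, ∀ x ∈ B i ∩ B j, ∀ y ∈ B i ∩ B j, F i x * star (F j x) = F i y * star (F j y)) :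
    FiberBundleCore X X (Discrete ℍ[ℝ]) where
  baseSet := B
  isOpen_baseSet := hB
  indexAt := id
  mem_baseSet_at := hmem
  coordChange i j x v := show ℍ[ℝ] from (show ℍ[ℝ] from v) * (F i x * star (F j x))
  coordChange_self i x hx v := by
    show (show ℍ[ℝ] from v) * (F i x * star (F i x)) = v
    rw [mul_star_self_of_norm (hF i x hx), mul_one]
  continuousOn_coordChange i j := by
    rintro ⟨x, v⟩ ⟨hx, -⟩
    refine ContinuousAt.continuousWithinAt ?_
    -- the transition function is locally constant in `x`, and the fibre is discrete
    refine (continuousAt_const (Y := Discrete ℍ[ℝ])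
      (y := (show ℍ[ℝ] from v) * (F i x * star (F j x)))).congr ?_
    rw [nhds_prod_eq, nhds_discrete (Discrete ℍ[ℝ])]
    refine Filter.mem_of_superset (prod_mem_prod (((hB i).inter (hB j)).mem_nhds hx)
      (mem_pure.2 (mem_singleton v))) ?_
    rintro ⟨y, w⟩ ⟨hy, rfl⟩
    exact congrArg (fun c => (show ℍ[ℝ] from w) * c) (hc i j x hx y hy)
  coordChange_comp i j k x hx v := by
    show (show ℍ[ℝ] from v) * (F i x * star (F j x)) * (F j x * star (F k x))
      = (show ℍ[ℝ] from v) * (F i x * star (F k x))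
    have : F i x * star (F j x) * (F j x * star (F k x)) = F i x * star (F k x) := by
      rw [mul_assoc, ← mul_assoc (star _), star_mul_self_of_norm (hF j x hx.1.2), one_mul]
    rw [mul_assoc, this]

/-- Solutions of `dF = F A`, for a flat imaginary one-form `A` on a simply connected open set, exist
globally: the germs of solutions form a covering space, which has a section. -/
theorem exists_global_solution {U : Set E} (hU : IsOpen U) (hUsc : IsSimplyConnected U)
    {A : E → E →L[ℝ] ℍ[ℝ]} (hA : ContDiffOn ℝ 2 A U)
    (him : ∀ z ∈ U, ∀ h, star (A z h) = -A z h)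
    (hflat : ∀ z ∈ U, ∀ h k : E,
      A z k * A z h + fderiv ℝ A z k h = A z h * A z k + fderiv ℝ A z h k)
    {z₀ : E} (hz₀ : z₀ ∈ U) (q₀ : ℍ[ℝ]) :
    ∃ F : E → ℍ[ℝ], F z₀ = q₀ ∧ ∀ z ∈ U, HasFDerivAt F (leftMulForm (F z) (A z)) z := by
  classical
  have := hUsc.simplyConnectedSpace
  have := hU.locallyPathConnectedSpace
  choose r hr hrU F hF0 hF using fun x : U => exists_local_solution hU hA hflat x.2
  have hFn : ∀ i : U, ∀ x ∈ ball (i : E) (r i), ‖F i x‖ = 1 := fun i x hx => by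
    refine norm_eq_one_of_mul_star ?_
    rw [mul_star_eq_of_solutions isOpen_ball (convex_ball _ _).isPreconnected
      (fun z hz => him z (hrU i hz)) (hF i) (hF i) hx (mem_ball_self (hr i)), hF0]
    simp
  set Z := solutionBundle (X := U) (fun i => {x | (x : E) ∈ ball (i : E) (r i)})
    (fun i x => F i x) (fun i => isOpen_ball.preimage continuous_subtype_val)
    (fun i => mem_ball_self (hr i)) (fun i x hx => hFn i x hx)
    (fun i j x hx y hy => mul_star_eq_of_solutions (isOpen_ball.inter isOpen_ball)
      ((convex_ball _ _).inter (convex_ball _ _)).isPreconnected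
      (fun z hz => him z (hrU i hz.1)) (fun z hz => hF i z hz.1) (fun z hz => hF j z hz.2) hx hy)
  have hcov : IsCoveringMap Z.proj := FiberBundle.isCoveringMap (F := Discrete ℍ[ℝ]) (E := Z.Fiber)
  obtain ⟨σ, ⟨hσ0, hσ⟩, -⟩ := hcov.existsUnique_continuousMap_lifts (ContinuousMap.id U) ⟨z₀, hz₀⟩
    (⟨⟨z₀, hz₀⟩, q₀⟩ : Z.TotalSpace) rfl
  -- the value of the germ `p` at its base point
  let ev : Z.TotalSpace → ℍ[ℝ] := fun p => (show ℍ[ℝ] from p.2) * F p.1 (p.1 : E)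
  have hσ1 : ∀ z : U, (σ z).1 = z := fun z => congrFun hσ z
  refine ⟨fun z => if hz : z ∈ U then ev (σ ⟨z, hz⟩) else 0, ?_, fun z hz => ?_⟩
  · simp only [dif_pos hz₀, hσ0, ev]
    rw [show F ⟨z₀, hz₀⟩ z₀ = 1 from hF0 ⟨z₀, hz₀⟩, mul_one]
  · have hcont : ContinuousAt (fun x : U => (Z.localTriv ⟨z, hz⟩ (σ x)).2) ⟨z, hz⟩ := by
      refine ContinuousAt.snd (ContinuousAt.comp (f := σ) (g := Z.localTriv ⟨z, hz⟩) ?_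
        σ.continuous.continuousAt)
      refine (Z.localTriv ⟨z, hz⟩).continuousAt ?_
      rw [Z.mem_localTriv_source, hσ1]
      exact mem_ball_self (hr ⟨z, hz⟩)
    set c : ℍ[ℝ] := (Z.localTriv ⟨z, hz⟩ (σ ⟨z, hz⟩)).2
    have hev : ∀ᶠ x : U in 𝓝 ⟨z, hz⟩, (Z.localTriv ⟨z, hz⟩ (σ x)).2 = c := by
      have := hcont.tendsto
      rw [nhds_discrete (Discrete ℍ[ℝ]), tendsto_pure] at this
      exact this
    have hev' : ∀ᶠ x in 𝓝 z, (if hz : x ∈ U then ev (σ ⟨x, hz⟩) else 0) = c * F ⟨z, hz⟩ x := by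
      have h1 : ∀ᶠ x in 𝓝 z, ∀ hx : x ∈ U, (Z.localTriv ⟨z, hz⟩ (σ ⟨x, hx⟩)).2 = c := by
        rw [nhds_subtype_eq_comap, eventually_comap] at hev
        filter_upwards [hev] with x hx hxU using hx ⟨x, hxU⟩ rfl
      filter_upwards [h1, hU.mem_nhds hz, ball_mem_nhds z (hr ⟨z, hz⟩)] with x hx hxU hxb
      rw [dif_pos hxU, ← hx hxU]
      show ev (σ ⟨x, hxU⟩) = (show ℍ[ℝ] from (σ ⟨x, hxU⟩).2) *
        (F (σ ⟨x, hxU⟩).1 ((σ ⟨x, hxU⟩).1 : E) * star (F ⟨z, hz⟩ ((σ ⟨x, hxU⟩).1 : E))) *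
          F ⟨z, hz⟩ x
      have e : (((σ ⟨x, hxU⟩).1 : U) : E) = x := congrArg Subtype.val (hσ1 ⟨x, hxU⟩)
      rw [e]
      show (show ℍ[ℝ] from (σ ⟨x, hxU⟩).2) * F (σ ⟨x, hxU⟩).1 ((σ ⟨x, hxU⟩).1 : E) = _
      generalize (show ℍ[ℝ] from (σ ⟨x, hxU⟩).2) = w
      rw [e, mul_assoc, mul_assoc, star_mul_self_of_norm (hFn ⟨z, hz⟩ x hxb), mul_one]
    have hd := ((hF ⟨z, hz⟩ z (mem_ball_self (hr ⟨z, hz⟩))).const_mul c).congr_of_eventuallyEq hev'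
    convert! hd using 1
    ext1 h
    simp only [leftMulForm_apply, hev'.self_of_nhds, mul_assoc]
    rfl

/-- Solutions of `dF = F A` are smooth if `A` is. -/
lemma contDiffOn_solution {U : Set E} (hU : IsOpen U) {A : E → E →L[ℝ] ℍ[ℝ]}
    (hA : ContDiffOn ℝ (⊤ : ℕ∞) A U) {F : E → ℍ[ℝ]}
    (hF : ∀ z ∈ U, HasFDerivAt F (leftMulForm (F z) (A z)) z) : ContDiffOn ℝ (⊤ : ℕ∞) F U := by
  have hn : ∀ n : ℕ, ContDiffOn ℝ n F U := by
    intro n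
    induction n with
    | zero => exact contDiffOn_zero.2 fun z hz => (hF z hz).continuousAt.continuousWithinAt
    | succ n ih =>
      push_cast
      rw [contDiffOn_succ_iff_fderiv_of_isOpen hU]
      refine ⟨fun z hz => (hF z hz).differentiableAt.differentiableWithinAt, by simp, ?_⟩
      refine ContDiffOn.congr (f := fun z => leftMulForm (F z) (A z)) ?_
        fun z hz => (hF z hz).fderiv
      have h1 : ContDiffOn ℝ n (fun z => ContinuousLinearMap.mul ℝ ℍ[ℝ] (F z)) U :=
        (ContinuousLinearMap.mul ℝ ℍ[ℝ]).contDiff.comp_contDiffOn ih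
      exact h1.clm_comp (hA.of_le (by exact_mod_cast le_top))
  exact contDiffOn_infty.2 hn

end Global

/-! ### Partial derivatives -/

section Calculus

variable {V : Type*} [NormedAddCommGroup V] [NormedSpace ℝ V]

lemma fderiv_eq_du_dv (f : ℂ → V) (z h : ℂ) :
    fderiv ℝ f z h = h.re • du f z + h.im • dv f z := by
  have : h = h.re • (1 : ℂ) + h.im • Complex.I := by apply Complex.ext <;> simp
  conv_lhs => rw [this, map_add, map_smul, map_smul]
  rfl

lemma differentiableAt_of_contDiffOn {E : Type*} [NormedAddCommGroup E] [NormedSpace ℝ E]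
    {U : Set E} (hU : IsOpen U) {f : E → V} (hf : ContDiffOn ℝ (⊤ : ℕ∞) f U)
    {z : E} (hz : z ∈ U) : DifferentiableAt ℝ f z :=
  (hf.contDiffAt (hU.mem_nhds hz)).differentiableAt (by simp)

variable {U : Set ℂ} (hU : IsOpen U) {f : ℂ → V} (hf : ContDiffOn ℝ (⊤ : ℕ∞) f U)
include hU hf

lemma contDiffOn_fderiv_apply (x : ℂ) : ContDiffOn ℝ (⊤ : ℕ∞) (fun z => fderiv ℝ f z x) U :=
  (hf.fderiv_of_isOpen hU (m := ((⊤ : ℕ∞) : WithTop ℕ∞)) (by simp)).clm_apply contDiffOn_const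

lemma contDiffOn_du : ContDiffOn ℝ (⊤ : ℕ∞) (du f) U := contDiffOn_fderiv_apply hU hf 1

lemma contDiffOn_dv : ContDiffOn ℝ (⊤ : ℕ∞) (dv f) U := contDiffOn_fderiv_apply hU hf Complex.I

lemma fderiv_fderiv_apply {z : ℂ} (hz : z ∈ U) (x y : ℂ) :
    fderiv ℝ (fun w => fderiv ℝ f w x) z y = fderiv ℝ (fderiv ℝ f) z y x := by
  have h1 : DifferentiableAt ℝ (fderiv ℝ f) z :=
    differentiableAt_of_contDiffOn hU
      (hf.fderiv_of_isOpen hU (m := ((⊤ : ℕ∞) : WithTop ℕ∞)) (by simp)) hz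
  rw [(h1.hasFDerivAt.clm_apply (hasFDerivAt_const x z)).fderiv]
  simp

lemma fderiv_fderiv_comm {z : ℂ} (hz : z ∈ U) (x y : ℂ) :
    fderiv ℝ (fun w => fderiv ℝ f w x) z y = fderiv ℝ (fun w => fderiv ℝ f w y) z x := by
  rw [fderiv_fderiv_apply hU hf hz, fderiv_fderiv_apply hU hf hz]
  exact ((hf.contDiffAt (hU.mem_nhds hz)).isSymmSndFDerivAt
    (by simpa using WithTop.coe_le_coe.2 (le_top : (2 : ℕ∞) ≤ ⊤))).eq y x

lemma dv_du {z : ℂ} (hz : z ∈ U) : dv (du f) z = du (dv f) z := fderiv_fderiv_comm hU hf hz _ _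

lemma laplacian_eq_du_dv {z : ℂ} (hz : z ∈ U) :
    Laplacian.laplacian f z = du (du f) z + dv (dv f) z := by
  rw [InnerProductSpace.laplacian_eq_iteratedFDeriv_complexPlane]
  simp only [iteratedFDeriv_two_apply]
  unfold du dv
  rw [fderiv_fderiv_apply hU hf hz, fderiv_fderiv_apply hU hf hz]
  rfl

end Calculus

/-! ### Flat systems in the coordinate `z = u + I v` -/

/-- The one-form `a du + b dv`. -/
def oneForm (a b : ℍ[ℝ]) : ℂ →L[ℝ] ℍ[ℝ] :=
  Complex.reCLM.smulRight a + Complex.imCLM.smulRight b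

lemma oneForm_apply (a b : ℍ[ℝ]) (h : ℂ) : oneForm a b h = h.re • a + h.im • b := rfl

lemma contDiffOn_oneForm {U : Set ℂ} {a b : ℂ → ℍ[ℝ]} {n : WithTop ℕ∞} (ha : ContDiffOn ℝ n a U)
    (hb : ContDiffOn ℝ n b U) : ContDiffOn ℝ n (fun z => oneForm (a z) (b z)) U :=
  (contDiffOn_const.smulRight ha).add (contDiffOn_const.smulRight hb)

/-- Integration of a flat imaginary system `F_u = F a`, `F_v = F b` on a simply connected domain. -/
theorem exists_solution {U : Set ℂ} (hU : IsOpen U) (hUsc : IsSimplyConnected U) {a b : ℂ → ℍ[ℝ]}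
    (ha : ContDiffOn ℝ (⊤ : ℕ∞) a U) (hb : ContDiffOn ℝ (⊤ : ℕ∞) b U)
    (hai : ∀ z ∈ U, star (a z) = -a z) (hbi : ∀ z ∈ U, star (b z) = -b z)
    (hflat : ∀ z ∈ U, du b z - dv a z + (a z * b z - b z * a z) = 0)
    {z₀ : ℂ} (hz₀ : z₀ ∈ U) {q₀ : ℍ[ℝ]} (hq₀ : ‖q₀‖ = 1) :
    ∃ F : ℂ → ℍ[ℝ], ContDiffOn ℝ (⊤ : ℕ∞) F U ∧ F z₀ = q₀ ∧ (∀ z ∈ U, ‖F z‖ = 1) ∧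
      ∀ z ∈ U, HasFDerivAt F (oneForm (F z * a z) (F z * b z)) z := by
  have hA := contDiffOn_oneForm ha hb
  have him : ∀ z ∈ U, ∀ h, star (oneForm (a z) (b z) h) = -oneForm (a z) (b z) h := by
    intro z hz h
    simp only [oneForm_apply, star_add, star_smul, hai z hz, hbi z hz, star_trivial]
    module
  have hd : ∀ z ∈ U, ∀ h k, fderiv ℝ (fun z => oneForm (a z) (b z)) z h k =
      oneForm (fderiv ℝ a z h) (fderiv ℝ b z h) k := by
    intro z hz h k
    have h1 := (differentiableAt_of_contDiffOn hU ha hz).hasFDerivAt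
    have h2 := (differentiableAt_of_contDiffOn hU hb hz).hasFDerivAt
    have h3 := (differentiableAt_of_contDiffOn hU hA hz).hasFDerivAt
    have h4 := h3.clm_apply (hasFDerivAt_const k z)
    have h5 : HasFDerivAt (fun z => oneForm (a z) (b z) k) _ z :=
      (h1.const_smul k.re).add (h2.const_smul k.im)
    have := congrArg (fun T : ℂ →L[ℝ] ℍ[ℝ] => T h) (h4.unique h5)
    simpa [oneForm_apply] using this
  obtain ⟨F, hF0, hF⟩ := exists_global_solution hU hUsc (hA.of_le (WithTop.coe_le_coe.2 le_top)) him
    (fun z hz h k => by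
      rw [hd z hz, hd z hz]
      simp only [oneForm_apply, fderiv_eq_du_dv a, fderiv_eq_du_dv b]
      have := hflat z hz
      have e : du b z = dv a z + b z * a z - a z * b z := by
        rw [← sub_eq_zero, ← this]; abel
      rw [e]
      simp only [add_mul, mul_add, smul_mul_assoc, mul_smul_comm, smul_add, smul_sub]
      module) hz₀ q₀
  refine ⟨F, contDiffOn_solution hU hA hF, hF0, fun z hz => ?_, fun z hz => ?_⟩
  · refine norm_eq_one_of_mul_star ?_
    rw [mul_star_eq_of_solutions hU hUsc.isPathConnected.isConnected.isPreconnected him hF hF hz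
      hz₀, hF0, mul_star_self_of_norm hq₀]
  · convert! hF z hz using 1
    ext1 h
    simp [oneForm_apply, mul_add]

/-! ### The Lax pair of the sinh-Gordon equation -/

/-- The quaternion `i`. -/
def qi : ℍ[ℝ] := ⟨0, 1, 0, 0⟩

/-- The quaternion `j`. -/
def qj : ℍ[ℝ] := ⟨0, 0, 1, 0⟩

/-- The quaternion `k`. -/
def qk : ℍ[ℝ] := ⟨0, 0, 0, 1⟩

@[simp] lemma qi_re : qi.re = 0 := rfl
@[simp] lemma qi_imI : qi.imI = 1 := rfl
@[simp] lemma qi_imJ : qi.imJ = 0 := rfl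
@[simp] lemma qi_imK : qi.imK = 0 := rfl
@[simp] lemma qj_re : qj.re = 0 := rfl
@[simp] lemma qj_imI : qj.imI = 0 := rfl
@[simp] lemma qj_imJ : qj.imJ = 1 := rfl
@[simp] lemma qj_imK : qj.imK = 0 := rfl
@[simp] lemma qk_re : qk.re = 0 := rfl
@[simp] lemma qk_imI : qk.imI = 0 := rfl
@[simp] lemma qk_imJ : qk.imJ = 0 := rfl
@[simp] lemma qk_imK : qk.imK = 1 := rfl

/-- The `du`-coefficient of the Lax pair of the sinh-Gordon equation with sign `ε = ±1`. The
minimal surface is `F₊ F₋⁻¹` for solutions `F₊`, `F₋` of the two linear systems. -/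
def laxU (ω : ℂ → ℝ) (ε : ℝ) (z : ℂ) : ℍ[ℝ] :=
  (ε * (Real.exp (ω z / 2) / √2)) • qi + (Real.exp (-(ω z / 2)) / √2) • qj - (dv ω z / 4) • qk

/-- The `dv`-coefficient of the Lax pair of the sinh-Gordon equation with sign `ε = ±1`. -/
def laxV (ω : ℂ → ℝ) (ε : ℝ) (z : ℂ) : ℍ[ℝ] :=
  (Real.exp (-(ω z / 2)) / √2) • qi + (ε * (Real.exp (ω z / 2) / √2)) • qj + (du ω z / 4) • qk

section Existence

variable {U : Set ℂ} {ω : ℂ → ℝ}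

lemma contDiffOn_laxU (hU : IsOpen U) (hω : ContDiffOn ℝ (⊤ : ℕ∞) ω U) (ε : ℝ) :
    ContDiffOn ℝ (⊤ : ℕ∞) (laxU ω ε) U := by
  have := contDiffOn_dv hU hω
  unfold laxU
  fun_prop

lemma contDiffOn_laxV (hU : IsOpen U) (hω : ContDiffOn ℝ (⊤ : ℕ∞) ω U) (ε : ℝ) :
    ContDiffOn ℝ (⊤ : ℕ∞) (laxV ω ε) U := by
  have := contDiffOn_du hU hω
  unfold laxV
  fun_prop

lemma star_laxU (ω : ℂ → ℝ) (ε : ℝ) (z : ℂ) : star (laxU ω ε z) = -laxU ω ε z := by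
  ext <;> simp [laxU]

lemma star_laxV (ω : ℂ → ℝ) (ε : ℝ) (z : ℂ) : star (laxV ω ε z) = -laxV ω ε z := by
  ext <;> simp [laxV]

lemma hasFDerivAt_exp_mul {z : ℂ} (hd : DifferentiableAt ℝ ω z) (c d : ℝ) :
    HasFDerivAt (fun w => d * Real.exp (c * ω w))
      ((d * Real.exp (c * ω z) * c) • fderiv ℝ ω z) z := by
  have := ((hd.hasFDerivAt.const_mul c).exp).const_mul d
  convert! this using 1
  ext1 h
  simp
  ring

lemma fderiv_laxU (hU : IsOpen U) (hω : ContDiffOn ℝ (⊤ : ℕ∞) ω U) (ε : ℝ) {z : ℂ} (hz : z ∈ U)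
    (h : ℂ) : fderiv ℝ (laxU ω ε) z h =
      (ε * (Real.exp (ω z / 2) / √2) / 2 * fderiv ℝ ω z h) • qi
      - (Real.exp (-(ω z / 2)) / √2 / 2 * fderiv ℝ ω z h) • qj
      - (fderiv ℝ (dv ω) z h / 4) • qk := by
  have hd := differentiableAt_of_contDiffOn hU hω hz
  have h1 := hasFDerivAt_exp_mul hd (1 / 2) (ε / √2)
  have h2 := hasFDerivAt_exp_mul hd (-1 / 2) (1 / √2)
  have h3 := (differentiableAt_of_contDiffOn hU (contDiffOn_dv hU hω) hz).hasFDerivAt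
  have h4 := ((h1.smul_const qi).add (h2.smul_const qj)).sub ((h3.const_mul (1 / 4)).smul_const qk)
  have e : laxU ω ε = fun w => (ε / √2 * Real.exp (1 / 2 * ω w)) • qi
      + (1 / √2 * Real.exp (-1 / 2 * ω w)) • qj - (1 / 4 * dv ω w) • qk := by
    ext1 w
    unfold laxU
    congr 3 <;> ring_nf
  rw [e]
  refine (congrArg (fun T : ℂ →L[ℝ] ℍ[ℝ] => T h) h4.fderiv).trans ?_
  simp only [sub_apply, add_apply, ContinuousLinearMap.smulRight_apply,
    smul_apply, smul_eq_mul]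
  rw [show -(ω z / 2) = -1 / 2 * ω z by ring, show ω z / 2 = 1 / 2 * ω z by ring]
  module

lemma fderiv_laxV (hU : IsOpen U) (hω : ContDiffOn ℝ (⊤ : ℕ∞) ω U) (ε : ℝ) {z : ℂ} (hz : z ∈ U)
    (h : ℂ) : fderiv ℝ (laxV ω ε) z h =
      -(Real.exp (-(ω z / 2)) / √2 / 2 * fderiv ℝ ω z h) • qi
      + (ε * (Real.exp (ω z / 2) / √2) / 2 * fderiv ℝ ω z h) • qj
      + (fderiv ℝ (du ω) z h / 4) • qk := by
  have hd := differentiableAt_of_contDiffOn hU hω hz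
  have h1 := hasFDerivAt_exp_mul hd (1 / 2) (ε / √2)
  have h2 := hasFDerivAt_exp_mul hd (-1 / 2) (1 / √2)
  have h3 := (differentiableAt_of_contDiffOn hU (contDiffOn_du hU hω) hz).hasFDerivAt
  have h4 := ((h2.smul_const qi).add (h1.smul_const qj)).add ((h3.const_mul (1 / 4)).smul_const qk)
  have e : laxV ω ε = fun w => (1 / √2 * Real.exp (-1 / 2 * ω w)) • qi
      + (ε / √2 * Real.exp (1 / 2 * ω w)) • qj + (1 / 4 * du ω w) • qk := by
    ext1 w
    unfold laxV
    congr 3 <;> ring_nf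
  rw [e]
  refine (congrArg (fun T : ℂ →L[ℝ] ℍ[ℝ] => T h) h4.fderiv).trans ?_
  simp only [add_apply, ContinuousLinearMap.smulRight_apply,
    smul_apply, smul_eq_mul]
  rw [show -(ω z / 2) = -1 / 2 * ω z by ring, show ω z / 2 = 1 / 2 * ω z by ring]
  module

lemma exp_half_div_sqrt_two_sq (x : ℝ) : (Real.exp (x / 2) / √2) ^ 2 = Real.exp x / 2 := by
  rw [div_pow, Real.sq_sqrt (by norm_num), ← Real.exp_nat_mul]
  congr 2
  push_cast
  ring

/-- The zero curvature equation of the Lax pair is the sinh-Gordon equation. -/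
lemma lax_flat (hU : IsOpen U) (hω : IsSinhGordonSolution U ω) {ε : ℝ} (hε : ε ^ 2 = 1)
    {z : ℂ} (hz : z ∈ U) :
    du (laxV ω ε) z - dv (laxU ω ε) z
      + (laxU ω ε z * laxV ω ε z - laxV ω ε z * laxU ω ε z) = 0 := by
  have hl := hω.2 z hz
  rw [laplacian_eq_du_dv hU hω.1 hz, Real.sinh_eq] at hl
  unfold du dv at *
  rw [fderiv_laxU hU hω.1 ε hz, fderiv_laxV hU hω.1 ε hz]
  have hs := exp_half_div_sqrt_two_sq (ω z)
  have hr := exp_half_div_sqrt_two_sq (-ω z)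
  rw [neg_div] at hr
  unfold laxU laxV
  unfold du dv at *
  generalize Real.exp (ω z / 2) / √2 = s at *
  generalize Real.exp (-(ω z / 2)) / √2 = r at *
  ext
  · simp; ring
  · simp; ring
  · simp; ring
  · simp
    linear_combination hl / 4 + 2 * s ^ 2 * hε + 2 * hs - 2 * hr

end Existence

/-! ### The minimal surface of a pair of Lax frames -/

lemma inner_eq_coord (a b : ℍ[ℝ]) :
    inner ℝ a b = a.re * b.re + a.imI * b.imI + a.imJ * b.imJ + a.imK * b.imK := by
  rw [Quaternion.inner_def]
  simp

lemma inner_mul_left_of_norm {a : ℍ[ℝ]} (ha : ‖a‖ = 1) (x y : ℍ[ℝ]) :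
    inner ℝ (a * x) (a * y) = inner ℝ x y := by
  simp only [real_inner_eq_norm_add_mul_self_sub_norm_mul_self_sub_norm_mul_self_div_two,
    ← mul_add, norm_mul, ha, one_mul]

lemma inner_mul_right_of_norm {a : ℍ[ℝ]} (ha : ‖a‖ = 1) (x y : ℍ[ℝ]) :
    inner ℝ (x * a) (y * a) = inner ℝ x y := by
  simp only [real_inner_eq_norm_add_mul_self_sub_norm_mul_self_sub_norm_mul_self_div_two,
    ← add_mul, norm_mul, ha, mul_one]

/-- The derivative of `F X G⁻¹`, for solutions `F`, `G` of two linear systems: with respect to the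
frames `F`, `G` it is a covariant derivative of `X`. -/
lemma fderiv_mul_mul_star {F G X : ℂ → ℍ[ℝ]} {a b a' b' : ℍ[ℝ]} {X' : ℂ →L[ℝ] ℍ[ℝ]} {z : ℂ}
    (hF : HasFDerivAt F (oneForm (F z * a) (F z * b)) z)
    (hG : HasFDerivAt G (oneForm (G z * a') (G z * b')) z)
    (ha : star a' = -a') (hb : star b' = -b') (hX : HasFDerivAt X X' z) (h : ℂ) :
    fderiv ℝ (fun w => F w * X w * star (G w)) z h =
      F z * (oneForm a b h * X z + X' h - X z * oneForm a' b' h) * star (G z) := by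
  have := ((hF.mul' hX).mul' hG.star)
  refine (congrArg (fun T : ℂ →L[ℝ] ℍ[ℝ] => T h) this.fderiv).trans ?_
  simp only [add_apply, smul_apply, ContinuousLinearMap.comp_apply, oneForm_apply,
    ContinuousLinearEquiv.coe_coe, starL'_apply, star_add, star_smul, star_mul, ha, hb,
    star_trivial, smul_eq_mul, MulOpposite.smul_eq_mul_unop, MulOpposite.unop_op]
  simp only [mul_add, add_mul, mul_sub, sub_mul, smul_mul_assoc, mul_smul_comm, mul_assoc,
    neg_mul, mul_neg, smul_neg, Pi.mul_apply]
  abel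

lemma sqrt_two_mul_exp_sq (x : ℝ) : (√2 * Real.exp (x / 2)) ^ 2 = 2 * Real.exp x := by
  rw [mul_pow, Real.sq_sqrt (by norm_num), ← Real.exp_nat_mul]
  congr 2
  push_cast
  ring

/-- Two orthogonal vectors of the same positive length in the plane form a conformal matrix. -/
lemma conformal_pair {a b c d N : ℝ} (hN : 0 < N) (h1 : a ^ 2 + b ^ 2 = N) (h2 : c ^ 2 + d ^ 2 = N)
    (h3 : a * c + b * d = 0) : a ^ 2 = d ^ 2 ∧ b ^ 2 = c ^ 2 := by
  have : N * (a ^ 2 - d ^ 2) = 0 := by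
    linear_combination (d ^ 2) * h1 - (a ^ 2) * h2 + (a * c - b * d) * h3
  have h4 : a ^ 2 = d ^ 2 := by
    rcases mul_eq_zero.1 this with h | h
    · exact absurd h hN.ne'
    · linarith
  exact ⟨h4, by linarith⟩

/-- Solutions `F`, `G` of the Lax pair with signs `1`, `-1` give the minimal surface `p = F G⁻¹`.
Its tangent vectors are `p_u = √2 e^{ω/2} F i G⁻¹` and `p_v = √2 e^{ω/2} F j G⁻¹` and its normal is
`F k G⁻¹`. So the induced metric is `2 e^ω` times the flat one, and the second fundamental form
comes out as `diag(-2, 2)`, whence `p` is minimal and `σ(∂z, ∂z) = -1`. -/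
theorem isAssociatedMinimalSurface_of_frame {U : Set ℂ} (hU : IsOpen U) {ω : ℂ → ℝ}
    (hω : ContDiffOn ℝ (⊤ : ℕ∞) ω U) {F G : ℂ → ℍ[ℝ]}
    (hFs : ContDiffOn ℝ (⊤ : ℕ∞) F U) (hGs : ContDiffOn ℝ (⊤ : ℕ∞) G U)
    (hFn : ∀ z ∈ U, ‖F z‖ = 1) (hGn : ∀ z ∈ U, ‖G z‖ = 1)
    (hF : ∀ z ∈ U, HasFDerivAt F (oneForm (F z * laxU ω 1 z) (F z * laxV ω 1 z)) z)
    (hG : ∀ z ∈ U, HasFDerivAt G (oneForm (G z * laxU ω (-1) z) (G z * laxV ω (-1) z)) z) :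
    IsAssociatedMinimalSurface U ω (fun z => F z * star (G z)) := by
  set p : ℂ → ℍ[ℝ] := fun z => F z * star (G z) with hp
  have hdp : ∀ z ∈ U, ∀ h, fderiv ℝ p z h =
      F z * ((√2 * Real.exp (ω z / 2)) • oneForm qi qj h) * star (G z) := by
    intro z hz h
    have := fderiv_mul_mul_star (hF z hz) (hG z hz) (star_laxU ω _ z) (star_laxV ω _ z)
      (hasFDerivAt_const 1 z) h
    simp only [mul_one, one_mul, zero_apply, add_zero] at this
    rw [hp, this]
    congr 2
    have hs2 : √2 * √2 = 2 := Real.mul_self_sqrt (by norm_num)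
    have h2 : Real.exp (ω z / 2) / √2 = √2 * Real.exp (ω z / 2) / 2 := by
      field_simp
      linear_combination - hs2
    simp only [oneForm_apply, laxU, laxV, h2]
    module
  have hstar : ∀ z ∈ U, ‖star (G z)‖ = 1 := fun z hz => by rw [norm_star, hGn z hz]
  have hpn : ∀ z ∈ U, ‖p z‖ = 1 := fun z hz => by simp [hp, hFn z hz, hGn z hz]
  have hin : ∀ z ∈ U, ∀ x y, inner ℝ (fderiv ℝ p z x) (fderiv ℝ p z y) =
      2 * Real.exp (ω z) * (x.re * y.re + x.im * y.im) := by
    intro z hz x y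
    rw [hdp z hz, hdp z hz, inner_mul_right_of_norm (hstar z hz), inner_mul_left_of_norm (hFn z hz),
      inner_smul_left, inner_smul_right, ← sqrt_two_mul_exp_sq, inner_eq_coord]
    simp [oneForm_apply]
    ring
  have hN : ∀ z ∈ U, unitNormal p z = F z * qk * star (G z) := by
    intro z hz
    have ha : ∀ x, star (p z) * fderiv ℝ p z x =
        (√2 * Real.exp (ω z / 2)) • (G z * oneForm qi qj x * star (G z)) := by
      intro x
      rw [hdp z hz, hp, star_mul, star_star]
      calc _ = G z * (star (F z) * F z) * ((√2 * Real.exp (ω z / 2)) • oneForm qi qj x)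
            * star (G z) := by noncomm_ring
        _ = _ := by
          rw [star_mul_self_of_norm (hFn z hz)]
          simp
    have hcross : cross (alpha2 p z) (alpha3 p z) =
        (2 * Real.exp (ω z)) • (G z * qk * star (G z)) := by
      unfold cross alpha2 alpha3 du dv
      rw [ha, ha, ← sqrt_two_mul_exp_sq]
      have hGG := star_mul_self_of_norm (hGn z hz)
      have e : ∀ x y : ℍ[ℝ], (G z * x * star (G z)) * (G z * y * star (G z))
          = G z * (x * y) * star (G z) := by
        intro x y
        calc _ = G z * x * (star (G z) * G z) * y * star (G z) := by noncomm_ring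
          _ = _ := by rw [hGG]; noncomm_ring
      have hij : qk = (1 / 2 : ℝ) • (qi * qj - qj * qi) := by ext <;> norm_num
      have o1 : oneForm qi qj 1 = qi := by simp [oneForm_apply]
      have o2 : oneForm qi qj Complex.I = qj := by simp [oneForm_apply]
      rw [o1, o2, smul_mul_smul_comm, smul_mul_smul_comm, e, e, hij]
      simp only [mul_sub, sub_mul, mul_smul_comm, smul_mul_assoc]
      module
    unfold unitNormal
    have hnk : ‖qk‖ = 1 := by
      have : ‖qk‖ * ‖qk‖ = 1 := by
        rw [← Quaternion.normSq_eq_norm_mul_self, Quaternion.normSq_def']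
        simp
      nlinarith [norm_nonneg qk]
    have hpos : 0 < 2 * Real.exp (ω z) := by positivity
    rw [hcross, norm_smul, norm_mul (G z * qk), norm_mul (G z), hGn z hz, hstar z hz, hnk,
      Real.norm_of_nonneg hpos.le]
    simp only [mul_one, mul_smul_comm, smul_smul, inv_mul_cancel₀ hpos.ne', one_smul]
    calc _ = F z * (star (G z) * G z) * qk * star (G z) := by simp only [hp]; noncomm_ring
      _ = _ := by rw [star_mul_self_of_norm (hGn z hz), mul_one]
  have hsff : ∀ z ∈ U, ∀ x y, sff p z x y = 2 * (x.im * y.im - x.re * y.re) := by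
    intro z hz x y
    have hev : (fun w => fderiv ℝ p w x) =ᶠ[𝓝 z]
        fun w => F w * ((√2 * Real.exp (1 / 2 * ω w)) • oneForm qi qj x) * star (G w) := by
      filter_upwards [hU.mem_nhds hz] with w hw
      rw [hdp w hw, show ω w / 2 = 1 / 2 * ω w by ring]
    unfold sff
    rw [hev.fderiv_eq, fderiv_mul_mul_star (hF z hz) (hG z hz) (star_laxU ω _ z) (star_laxV ω _ z)
      ((hasFDerivAt_exp_mul (differentiableAt_of_contDiffOn hU hω hz) (1 / 2) (√2)).smul_const
        (oneForm qi qj x)) y, hN z hz,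
      inner_mul_right_of_norm (hstar z hz), inner_mul_left_of_norm (hFn z hz), inner_eq_coord]
    have hE : Real.exp (ω z / 2) * Real.exp (-(ω z / 2)) = 1 := by
      rw [← Real.exp_add, add_neg_cancel, Real.exp_zero]
    have hs : √2 ≠ 0 := by positivity
    have hE' : √2 * Real.exp (1 / 2 * ω z) * (Real.exp (-(ω z / 2)) / √2) = 1 := by
      rw [show 1 / 2 * ω z = ω z / 2 by ring]
      field_simp
      exact hE
    simp [oneForm_apply, laxU, laxV]
    simp only [one_div] at hE'
    linear_combination 2 * (x.im * y.im - x.re * y.re) * hE'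
  refine ⟨hFs.mul ?_, hpn, ?_, ?_, ?_, ?_, ?_⟩
  · exact (starL' ℝ : ℍ[ℝ] ≃L[ℝ] ℍ[ℝ]).contDiff.comp_contDiffOn hGs
  · intro z hz; simp only [du]; rw [hin z hz]; simp
  · intro z hz; simp only [dv]; rw [hin z hz]; simp
  · intro z hz; simp only [du, dv]; rw [hin z hz]; simp
  · intro z hz x y hx hy hxy
    have e : ∀ w : ℂ, ‖fderiv ℝ p z w‖ = 1 →
        w.re ^ 2 + w.im ^ 2 = (2 * Real.exp (ω z))⁻¹ := by
      intro w hw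
      have h1 := hin z hz w w
      rw [real_inner_self_eq_norm_mul_norm, hw] at h1
      field_simp
      linear_combination -h1
    rw [hin z hz] at hxy
    have hpos : 0 < 2 * Real.exp (ω z) := by positivity
    obtain ⟨h1, h2⟩ := conformal_pair (inv_pos.2 hpos) (e x hx) (e y hy)
      ((mul_eq_zero.1 hxy).resolve_left hpos.ne')
    rw [hsff z hz, hsff z hz]
    linear_combination 2 * h2 - 2 * h1
  · intro z hz
    simp only [sffC, partialZ, hsff z hz]
    norm_num

theorem exists_isAssociatedMinimalSurface {U : Set ℂ} (hU : IsOpen U) (hUsc : IsSimplyConnected U)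
    {ω : ℂ → ℝ} (hω : IsSinhGordonSolution U ω) :
    ∃ p : ℂ → ℍ[ℝ], IsAssociatedMinimalSurface U ω p := by
  obtain ⟨z₀, hz₀⟩ := hUsc.nonempty
  have hex : ∀ ε : ℝ, ε ^ 2 = 1 → _ := fun ε hε =>
    exists_solution hU hUsc (contDiffOn_laxU hU hω.1 ε) (contDiffOn_laxV hU hω.1 ε)
      (fun z _ => star_laxU ω ε z) (fun z _ => star_laxV ω ε z)
      (fun z hz => lax_flat hU hω hε hz) hz₀ (q₀ := 1) norm_one
  obtain ⟨F, hFs, -, hFn, hF⟩ := hex 1 (by norm_num)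
  obtain ⟨G, hGs, -, hGn, hG⟩ := hex (-1) (by norm_num)
  exact ⟨_, isAssociatedMinimalSurface_of_frame hU hω.1 hFs hGs hFn hGn hF hG⟩

/-! ### The structure equations of the minimal surface -/

/-- `a` and `b` are imaginary, orthogonal and of squared length `2 e`, expressed through their
products. -/
structure IsImPair (a b : ℍ[ℝ]) (e : ℝ) : Prop where
  pos : 0 < e
  star_a : star a = -a
  star_b : star b = -b
  aa : a * a = -((2 * e) • (1 : ℍ[ℝ]))
  bb : b * b = -((2 * e) • (1 : ℍ[ℝ]))
  ba : b * a = -(a * b)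

lemma star_mul_add_star_mul (a b : ℍ[ℝ]) :
    star a * b + star b * a = (2 * inner ℝ a b) • (1 : ℍ[ℝ]) := by
  rw [inner_eq_coord]
  ext <;> simp <;> ring

lemma IsImPair.of_inner {a b : ℍ[ℝ]} {e : ℝ} (he : 0 < e) (ha : star a = -a) (hb : star b = -b)
    (haa : inner ℝ a a = 2 * e) (hbb : inner ℝ b b = 2 * e) (hab : inner ℝ a b = 0) :
    IsImPair a b e := by
  have h1 := star_mul_add_star_mul a a
  have h2 := star_mul_add_star_mul b b
  have h3 := star_mul_add_star_mul a b
  rw [haa, ha] at h1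
  rw [hbb, hb] at h2
  rw [hab, ha, hb] at h3
  refine ⟨he, ha, hb, ?_, ?_, ?_⟩
  · have : (2 : ℝ) • (a * a + (2 * e) • (1 : ℍ[ℝ])) = 0 := by
      rw [smul_add, smul_smul, ← h1, neg_mul]; module
    exact eq_neg_of_add_eq_zero_left ((smul_eq_zero.1 this).resolve_left two_ne_zero)
  · have : (2 : ℝ) • (b * b + (2 * e) • (1 : ℍ[ℝ])) = 0 := by
      rw [smul_add, smul_smul, ← h2, neg_mul]; module
    exact eq_neg_of_add_eq_zero_left ((smul_eq_zero.1 this).resolve_left two_ne_zero)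
  · simp only [mul_zero, zero_smul, neg_mul] at h3
    rw [eq_neg_iff_add_eq_zero, ← neg_eq_zero, ← h3]
    abel

namespace IsImPair

variable {a b : ℍ[ℝ]} {e : ℝ} (h : IsImPair a b e)
include h

lemma cross_eq : cross a b = a * b := by
  unfold cross
  rw [h.ba]
  module

lemma a_ab : a * (a * b) = -((2 * e) • b) := by rw [← mul_assoc, h.aa]; simp

lemma ab_b : a * b * b = -((2 * e) • a) := by rw [mul_assoc, h.bb]; simp

lemma b_ab : b * (a * b) = (2 * e) • a := by rw [← mul_assoc, h.ba, neg_mul, h.ab_b, neg_neg]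

lemma ab_a : a * b * a = (2 * e) • b := by
  rw [mul_assoc, h.ba, mul_neg, h.a_ab, neg_neg]

lemma ab_ab : a * b * (a * b) = -((4 * e ^ 2) • (1 : ℍ[ℝ])) := by
  rw [mul_assoc, h.b_ab, mul_smul_comm, h.aa]
  module

lemma star_ab : star (a * b) = -(a * b) := by
  rw [star_mul, h.star_a, h.star_b, neg_mul_neg, h.ba]

lemma inner_aa : inner ℝ a a = 2 * e := by
  have h1 := congrArg (fun q : ℍ[ℝ] => q.re) (star_mul_add_star_mul a a)
  rw [h.star_a, neg_mul, h.aa] at h1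
  simp [-inner_self_eq_norm_sq_to_K] at h1
  linarith

lemma inner_bb : inner ℝ b b = 2 * e := by
  have h1 := congrArg (fun q : ℍ[ℝ] => q.re) (star_mul_add_star_mul b b)
  rw [h.star_b, neg_mul, h.bb] at h1
  simp [-inner_self_eq_norm_sq_to_K] at h1
  linarith

lemma inner_ab : inner ℝ a b = 0 := by
  have h1 := congrArg (fun q : ℍ[ℝ] => q.re) (star_mul_add_star_mul a b)
  rw [h.star_a, h.star_b, neg_mul, neg_mul, h.ba, neg_neg, neg_add_cancel] at h1
  simpa using h1

lemma inner_a_ab : inner ℝ a (a * b) = 0 := by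
  have h1 := congrArg (fun q : ℍ[ℝ] => q.re) (star_mul_add_star_mul a (a * b))
  rw [h.star_a, h.star_ab, neg_mul, neg_mul, h.ab_a, h.a_ab, neg_neg, add_neg_cancel] at h1
  simpa using h1

lemma inner_b_ab : inner ℝ b (a * b) = 0 := by
  have h1 := congrArg (fun q : ℍ[ℝ] => q.re) (star_mul_add_star_mul b (a * b))
  rw [h.star_b, h.star_ab, neg_mul, neg_mul, h.ab_b, h.b_ab, neg_neg, neg_add_cancel] at h1
  simpa using h1

lemma inner_ab_ab : inner ℝ (a * b) (a * b) = 4 * e ^ 2 := by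
  have h1 := congrArg (fun q : ℍ[ℝ] => q.re) (star_mul_add_star_mul (a * b) (a * b))
  rw [h.star_ab, neg_mul, h.ab_ab] at h1
  simp [-inner_self_eq_norm_sq_to_K] at h1
  linarith

lemma norm_ab : ‖a * b‖ = 2 * e := by
  have h1 := h.inner_ab_ab
  rw [real_inner_self_eq_norm_mul_norm] at h1
  nlinarith [norm_nonneg (a * b), h.pos]

omit h in
lemma inner_one_im {x : ℍ[ℝ]} (hx : star x = -x) : inner ℝ (1 : ℍ[ℝ]) x = 0 := by
  have := congrArg (fun q : ℍ[ℝ] => q.re) hx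
  simp at this
  rw [inner_eq_coord]
  simp
  linarith

/-- `1, a, b, ab` span the quaternions: an imaginary quaternion orthogonal to `a` and `b`
anticommutes with both, hence commutes with `ab`; if it is orthogonal to `ab` it also anticommutes
with `ab`. -/
lemma eq_zero_of_inner {y : ℍ[ℝ]} (h1 : inner ℝ y 1 = 0) (ha : inner ℝ y a = 0)
    (hb : inner ℝ y b = 0) (hab : inner ℝ y (a * b) = 0) : y = 0 := by
  have hy : star y = -y := by
    rw [inner_eq_coord] at h1
    simp at h1
    ext <;> simp [h1]
  have key : ∀ {x : ℍ[ℝ]}, star x = -x → inner ℝ y x = 0 → y * x = -(x * y) := by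
    intro x hx hxy
    have := star_mul_add_star_mul y x
    rw [hxy, hx, hy] at this
    simp only [mul_zero, zero_smul, neg_mul] at this
    rw [eq_neg_iff_add_eq_zero, ← neg_eq_zero, ← this]
    abel
  have e1 := key h.star_a ha
  have e2 := key h.star_b hb
  have e3 := key h.star_ab hab
  have e4 : y * (a * b) = a * b * y := by
    rw [← mul_assoc, e1, neg_mul, mul_assoc, e2, mul_neg, neg_neg, mul_assoc]
  have e5 : y * (a * b) = 0 := by
    rw [e4] at e3
    rw [e4]
    have : (2 : ℝ) • (a * b * y) = 0 := by
      rw [two_smul]; nth_rw 1 [e3]; exact neg_add_cancel _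
    exact (smul_eq_zero.1 this).resolve_left two_ne_zero
  rcases mul_eq_zero.1 e5 with h0 | h0
  · exact h0
  · have := h.norm_ab
    rw [h0, norm_zero] at this
    linarith [h.pos]

/-- Expansion of a quaternion in the orthogonal basis `1, a, b, ab`. -/
lemma expand {x : ℍ[ℝ]} {c₀ c₁ c₂ c₃ : ℝ} (h1 : inner ℝ x 1 = c₀) (ha : inner ℝ x a = 2 * e * c₁)
    (hb : inner ℝ x b = 2 * e * c₂) (hab : inner ℝ x (a * b) = 4 * e ^ 2 * c₃) :
    x = c₀ • 1 + c₁ • a + c₂ • b + c₃ • (a * b) := by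
  rw [← sub_eq_zero]
  have i1 := inner_one_im h.star_a
  have i2 := inner_one_im h.star_b
  have i3 := inner_one_im h.star_ab
  have i4 := h.inner_ab
  have i5 := h.inner_a_ab
  have i6 := h.inner_b_ab
  have j0 : inner ℝ (1 : ℍ[ℝ]) 1 = 1 := by rw [inner_eq_coord]; simp
  refine h.eq_zero_of_inner ?_ ?_ ?_ ?_ <;>
  simp only [inner_sub_left, inner_add_left, real_inner_smul_left, h1, ha, hb, hab, j0, i1, i2, i3,
    i4, i5, i6, real_inner_comm (1 : ℍ[ℝ]) a, real_inner_comm (1 : ℍ[ℝ]) b,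
    real_inner_comm (1 : ℍ[ℝ]) (a * b), real_inner_comm a b, real_inner_comm a (a * b),
    real_inner_comm b (a * b), h.inner_aa, h.inner_bb, h.inner_ab_ab] <;> ring

end IsImPair

lemma inner_fderiv_of_eventually {f g : ℂ → ℍ[ℝ]} {φ : ℂ → ℝ} {φ' : ℂ →L[ℝ] ℝ} {z : ℂ}
    (hf : DifferentiableAt ℝ f z) (hg : DifferentiableAt ℝ g z)
    (h : (fun w => inner ℝ (f w) (g w)) =ᶠ[𝓝 z] φ) (hφ : HasFDerivAt φ φ' z) (x : ℂ) :
    inner ℝ (f z) (fderiv ℝ g z x) + inner ℝ (fderiv ℝ f z x) (g z) = φ' x := by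
  rw [← fderiv_inner_apply ℝ hf hg, h.fderiv_eq, hφ.fderiv]

namespace IsAssociatedMinimalSurface

variable {U : Set ℂ} {ω : ℂ → ℝ} {p : ℂ → ℍ[ℝ]} (hp : IsAssociatedMinimalSurface U ω p)
  (hU : IsOpen U)

include hp hU

lemma star_star_mul_fderiv {z : ℂ} (hz : z ∈ U) (h : ℂ) :
    star (star (p z) * fderiv ℝ p z h) = -(star (p z) * fderiv ℝ p z h) := by
  have hd := (differentiableAt_of_contDiffOn hU hp.smooth hz).hasFDerivAt
  have h1 := hd.star.mul' hd
  have h2 : (fun w => star (p w)) * p =ᶠ[𝓝 z] fun _ => 1 := by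
    filter_upwards [hU.mem_nhds hz] with w hw
    exact star_mul_self_of_norm (hp.mem_sphere w hw)
  have h3 := congrArg (fun T : ℂ →L[ℝ] ℍ[ℝ] => T h)
    (h1.fderiv.symm.trans (h2.fderiv_eq.trans (hasFDerivAt_const (1 : ℍ[ℝ]) z).fderiv))
  simp at h3
  rw [star_mul, star_star, eq_neg_iff_add_eq_zero, ← h3]
  abel

lemma isImPair {z : ℂ} (hz : z ∈ U) : IsImPair (alpha2 p z) (alpha3 p z) (Real.exp (ω z)) := by
  have hs : ‖star (p z)‖ = 1 := by rw [norm_star, hp.mem_sphere z hz]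
  refine .of_inner (Real.exp_pos _) (hp.star_star_mul_fderiv hU hz _)
    (hp.star_star_mul_fderiv hU hz _) ?_ ?_ ?_ <;>
  simp only [alpha2, alpha3] <;> rw [inner_mul_left_of_norm hs]
  exacts [hp.inner_uu z hz, hp.inner_vv z hz, hp.inner_uv z hz]

omit hU in
lemma p_mul_star_mul {z : ℂ} (hz : z ∈ U) (x : ℍ[ℝ]) : p z * (star (p z) * x) = x := by
  rw [← mul_assoc, mul_star_self_of_norm (hp.mem_sphere z hz), one_mul]

lemma sff_eq {z : ℂ} (hz : z ∈ U) (x y : ℂ) : sff p z x y =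
    (2 * Real.exp (ω z))⁻¹ * inner ℝ (star (p z) * fderiv ℝ (fderiv ℝ p) z y x)
      (alpha2 p z * alpha3 p z) := by
  have h := hp.isImPair hU hz
  unfold sff unitNormal
  rw [h.cross_eq, h.norm_ab, inner_smul_right, fderiv_fderiv_apply hU hp.smooth hz]
  conv_lhs => rw [← hp.p_mul_star_mul hz (fderiv ℝ (fderiv ℝ p) z y x)]
  rw [inner_mul_left_of_norm (hp.mem_sphere z hz)]

/-- The conditions on trace and Hopf differential determine the second fundamental form. -/
lemma sff_values {z : ℂ} (hz : z ∈ U) :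
    sff p z 1 1 = -2 ∧ sff p z 1 Complex.I = 0 ∧ sff p z Complex.I Complex.I = 2 := by
  have hb : ∀ (r s : ℝ) (x y : ℂ), sff p z (r • x) (s • y) = r * s * sff p z x y := by
    intro r s x y
    simp only [hp.sff_eq hU hz, map_smul, smul_apply, mul_smul_comm, real_inner_smul_left]
    ring
  have hsym : sff p z Complex.I 1 = sff p z 1 Complex.I := by
    unfold sff
    rw [fderiv_fderiv_comm hU hp.smooth hz]
  have e1 : (1 / 2 : ℂ) = (1 / 2 : ℝ) • (1 : ℂ) := by simp
  have e2 : (-(Complex.I / 2) : ℂ) = (-1 / 2 : ℝ) • Complex.I := by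
    simp [div_eq_mul_inv, mul_comm]
  have hh := hp.hopf z hz
  simp only [sffC, partialZ, e1, e2, hb, hsym] at hh
  have hre := congrArg Complex.re hh
  have him := congrArg Complex.im hh
  simp at hre him
  have hpos : 0 < 2 * Real.exp (ω z) := by positivity
  -- `c` normalizes the coordinate vectors, which gives an orthonormal tangent basis
  set c : ℝ := (√(2 * Real.exp (ω z)))⁻¹ with hc
  have hc0 : 0 < c := by positivity
  have hcc : c * c * (2 * Real.exp (ω z)) = 1 := by
    rw [hc, ← mul_inv, Real.mul_self_sqrt hpos.le, inv_mul_cancel₀ hpos.ne']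
  have hn : ∀ v : ℍ[ℝ], inner ℝ v v = 2 * Real.exp (ω z) → ‖c • v‖ = 1 := by
    intro v hv
    rw [real_inner_self_eq_norm_mul_norm] at hv
    rw [norm_smul, Real.norm_of_nonneg hc0.le]
    have : (c * ‖v‖) * (c * ‖v‖) = 1 := by rw [← hcc, ← hv]; ring
    nlinarith [mul_nonneg hc0.le (norm_nonneg v)]
  have hm := hp.minimal z hz (c • 1) (c • Complex.I)
    (by rw [map_smul]; exact hn _ (hp.inner_uu z hz))
    (by rw [map_smul]; exact hn _ (hp.inner_vv z hz))
    (by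
      rw [map_smul, map_smul, real_inner_smul_left, real_inner_smul_right]
      have := hp.inner_uv z hz
      unfold du dv at this
      rw [this]; ring)
  rw [hb, hb, ← mul_add] at hm
  have hm' := (mul_eq_zero.1 hm).resolve_left (by positivity)
  refine ⟨?_, ?_, ?_⟩ <;> linarith

omit hU in
lemma inner_star_mul {z : ℂ} (hz : z ∈ U) (x y : ℍ[ℝ]) :
    inner ℝ (star (p z) * x) (star (p z) * y) = inner ℝ x y :=
  inner_mul_left_of_norm (by rw [norm_star, hp.mem_sphere z hz]) x y

lemma inner_fderiv_eq_zero {z : ℂ} (hz : z ∈ U) (x : ℂ) : inner ℝ (p z) (fderiv ℝ p z x) = 0 := by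
  rw [← hp.inner_star_mul hz, star_mul_self_of_norm (hp.mem_sphere z hz)]
  exact IsImPair.inner_one_im (hp.star_star_mul_fderiv hU hz x)

/-- The Gauss formulas. -/
lemma second_derivatives (hω : ContDiffOn ℝ (⊤ : ℕ∞) ω U) {z : ℂ} (hz : z ∈ U) :
    star (p z) * du (du p) z = (-(2 * Real.exp (ω z))) • 1 + (du ω z / 2) • alpha2 p z
      + (-(dv ω z / 2)) • alpha3 p z + (-(Real.exp (ω z))⁻¹) • (alpha2 p z * alpha3 p z) ∧
    star (p z) * dv (du p) z = (0 : ℝ) • 1 + (dv ω z / 2) • alpha2 p z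
      + (du ω z / 2) • alpha3 p z + (0 : ℝ) • (alpha2 p z * alpha3 p z) ∧
    star (p z) * dv (dv p) z = (-(2 * Real.exp (ω z))) • 1 + (-(du ω z / 2)) • alpha2 p z
      + (dv ω z / 2) • alpha3 p z + (Real.exp (ω z))⁻¹ • (alpha2 p z * alpha3 p z) := by
  have h := hp.isImPair hU hz
  have hn : U ∈ 𝓝 z := hU.mem_nhds hz
  have dp := differentiableAt_of_contDiffOn hU hp.smooth hz
  have dpu := differentiableAt_of_contDiffOn hU (contDiffOn_du hU hp.smooth) hz
  have dpv := differentiableAt_of_contDiffOn hU (contDiffOn_dv hU hp.smooth) hz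
  have dω : HasFDerivAt (fun w => 2 * Real.exp (ω w)) ((2 * Real.exp (ω z)) • fderiv ℝ ω z) z := by
    have := (differentiableAt_of_contDiffOn hU hω hz).hasFDerivAt.exp.const_mul 2
    rwa [smul_smul] at this
  have huu := inner_fderiv_of_eventually dpu dpu
    (by filter_upwards [hn] with w hw using hp.inner_uu w hw) dω
  have hvv := inner_fderiv_of_eventually dpv dpv
    (by filter_upwards [hn] with w hw using hp.inner_vv w hw) dω
  have huv := inner_fderiv_of_eventually dpu dpv
    (by filter_upwards [hn] with w hw using hp.inner_uv w hw) (hasFDerivAt_const (0 : ℝ) z)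
  have hpu := inner_fderiv_of_eventually dp dpu
    (by filter_upwards [hn] with w hw using hp.inner_fderiv_eq_zero hU hw 1)
    (hasFDerivAt_const (0 : ℝ) z)
  have hpv := inner_fderiv_of_eventually dp dpv
    (by filter_upwards [hn] with w hw using hp.inner_fderiv_eq_zero hU hw Complex.I)
    (hasFDerivAt_const (0 : ℝ) z)
  have hσ : ∀ x y, inner ℝ (star (p z) * fderiv ℝ (fun w => fderiv ℝ p w x) z y)
      (alpha2 p z * alpha3 p z) = 2 * Real.exp (ω z) * sff p z x y := by
    intro x y
    rw [hp.sff_eq hU hz, fderiv_fderiv_apply hU hp.smooth hz, ← mul_assoc,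
      mul_inv_cancel₀ (by positivity), one_mul]
  obtain ⟨s1, s2, s3⟩ := hp.sff_values hU hz
  have hiuu := hp.inner_uu z hz
  have hivv := hp.inner_vv z hz
  have hiuv := hp.inner_uv z hz
  have e1 : (1 : ℍ[ℝ]) = star (p z) * p z := (star_mul_self_of_norm (hp.mem_sphere z hz)).symm
  have hc := dv_du hU hp.smooth hz
  have hpos := Real.exp_pos (ω z)
  have u1 := huu 1
  have u2 := huu Complex.I
  have v1 := hvv 1
  have v2 := hvv Complex.I
  have w1 := huv 1
  have w2 := huv Complex.I
  have p1 := hpu 1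
  have p2 := hpu Complex.I
  have p4 := hpv Complex.I
  have t1 := hσ 1 1
  have t2 := hσ 1 Complex.I
  have t3 := hσ Complex.I Complex.I
  simp only [smul_apply, smul_eq_mul, zero_apply] at u1 u2 v1 v2 w1 w2 p1 p2 p4
  change _ + inner ℝ (du p z) (du p z) = _ at p1
  change _ + inner ℝ (dv p z) (du p z) = _ at p2
  change _ + inner ℝ (dv p z) (dv p z) = _ at p4
  rw [real_inner_comm (du p z) (dv p z)] at p2
  change inner ℝ (du p z) (du (du p) z) + inner ℝ (du (du p) z) (du p z) = _ * du ω z at u1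
  change inner ℝ (du p z) (dv (du p) z) + inner ℝ (dv (du p) z) (du p z) = _ * dv ω z at u2
  change inner ℝ (dv p z) (du (dv p) z) + inner ℝ (du (dv p) z) (dv p z) = _ * du ω z at v1
  change inner ℝ (dv p z) (dv (dv p) z) + inner ℝ (dv (dv p) z) (dv p z) = _ * dv ω z at v2
  change inner ℝ (du p z) (du (dv p) z) + inner ℝ (du (du p) z) (dv p z) = 0 at w1
  change inner ℝ (du p z) (dv (dv p) z) + inner ℝ (dv (du p) z) (dv p z) = 0 at w2
  change inner ℝ (p z) (du (du p) z) + _ = 0 at p1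
  change inner ℝ (p z) (dv (du p) z) + _ = 0 at p2
  change inner ℝ (p z) (dv (dv p) z) + _ = 0 at p4
  change inner ℝ (star (p z) * du (du p) z) _ = _ at t1
  change inner ℝ (star (p z) * dv (du p) z) _ = _ at t2
  change inner ℝ (star (p z) * dv (dv p) z) _ = _ at t3
  rw [← hc] at v1 w1
  rw [real_inner_comm (du (du p) z)] at u1 p1
  rw [real_inner_comm (dv (du p) z)] at u2 v1 w1 p2
  rw [real_inner_comm (dv (dv p) z)] at v2 w2 p4
  refine ⟨h.expand ?_ ?_ ?_ ?_, h.expand ?_ ?_ ?_ ?_, h.expand ?_ ?_ ?_ ?_⟩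
  all_goals
    first
    | rw [t1, s1]; field_simp; ring
    | rw [t2, s2]; ring
    | rw [t3, s3]; field_simp; norm_num
    | rw [e1, hp.inner_star_mul hz]; linarith
    | simp only [alpha2, alpha3]; rw [hp.inner_star_mul hz]; linarith

/-- The derivatives of `α₂` and `α₃`, with the term from the derivative of `p̄` included. -/
lemma fderiv_star_mul {z : ℂ} (hz : z ∈ U) (x y : ℂ) :
    fderiv ℝ (fun w => star (p w) * fderiv ℝ p w x) z y =
      star (p z) * fderiv ℝ (fun w => fderiv ℝ p w x) z y
        - star (p z) * fderiv ℝ p z y * (star (p z) * fderiv ℝ p z x) := by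
  have dp := (differentiableAt_of_contDiffOn hU hp.smooth hz).hasFDerivAt
  have dpx := (differentiableAt_of_contDiffOn hU (contDiffOn_fderiv_apply hU hp.smooth x)
    hz).hasFDerivAt
  refine (congrArg (fun T : ℂ →L[ℝ] ℍ[ℝ] => T y) (dp.star.mul' dpx).fderiv).trans ?_
  have e : star (fderiv ℝ p z y) = -(star (p z) * fderiv ℝ p z y * star (p z)) := by
    have := congrArg (· * star (p z)) (hp.star_star_mul_fderiv hU hz y)
    simp only [star_mul, star_star, mul_assoc, mul_star_self_of_norm (hp.mem_sphere z hz),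
      mul_one] at this
    rw [this, neg_mul]
  simp [e, mul_assoc, sub_eq_add_neg]

lemma du_alpha2 (hω : ContDiffOn ℝ (⊤ : ℕ∞) ω U) {z : ℂ} (hz : z ∈ U) :
    du (alpha2 p) z = (du ω z / 2) • alpha2 p z - (dv ω z / 2) • alpha3 p z
      - (Real.exp (ω z))⁻¹ • (alpha2 p z * alpha3 p z) := by
  have h := hp.fderiv_star_mul hU hz 1 1
  change du (alpha2 p) z = star (p z) * du (du p) z - alpha2 p z * alpha2 p z at h
  rw [h, (hp.second_derivatives hU hω hz).1, (hp.isImPair hU hz).aa]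
  module

lemma dv_alpha2 (hω : ContDiffOn ℝ (⊤ : ℕ∞) ω U) {z : ℂ} (hz : z ∈ U) :
    dv (alpha2 p) z = (dv ω z / 2) • alpha2 p z + (du ω z / 2) • alpha3 p z
      + alpha2 p z * alpha3 p z := by
  have h := hp.fderiv_star_mul hU hz 1 Complex.I
  change dv (alpha2 p) z = star (p z) * dv (du p) z - alpha3 p z * alpha2 p z at h
  rw [h, (hp.second_derivatives hU hω hz).2.1, (hp.isImPair hU hz).ba]
  module

lemma du_alpha3 (hω : ContDiffOn ℝ (⊤ : ℕ∞) ω U) {z : ℂ} (hz : z ∈ U) :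
    du (alpha3 p) z = (dv ω z / 2) • alpha2 p z + (du ω z / 2) • alpha3 p z
      - alpha2 p z * alpha3 p z := by
  have h := hp.fderiv_star_mul hU hz Complex.I 1
  change du (alpha3 p) z = star (p z) * du (dv p) z - alpha2 p z * alpha3 p z at h
  rw [h, ← dv_du hU hp.smooth hz, (hp.second_derivatives hU hω hz).2.1]
  module

lemma dv_alpha3 (hω : ContDiffOn ℝ (⊤ : ℕ∞) ω U) {z : ℂ} (hz : z ∈ U) :
    dv (alpha3 p) z = -(du ω z / 2) • alpha2 p z + (dv ω z / 2) • alpha3 p z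
      + (Real.exp (ω z))⁻¹ • (alpha2 p z * alpha3 p z) := by
  have h := hp.fderiv_star_mul hU hz Complex.I Complex.I
  change dv (alpha3 p) z = star (p z) * dv (dv p) z - alpha3 p z * alpha3 p z at h
  rw [h, (hp.second_derivatives hU hω hz).2.2, (hp.isImPair hU hz).bb]
  module

omit hp hU in
lemma contDiffOn_star_mul_fderiv (hU : IsOpen U) (hp : ContDiffOn ℝ (⊤ : ℕ∞) p U) (x : ℂ) :
    ContDiffOn ℝ (⊤ : ℕ∞) (fun w => star (p w) * fderiv ℝ p w x) U :=
  ((starL' ℝ : ℍ[ℝ] ≃L[ℝ] ℍ[ℝ]).contDiff.comp_contDiffOn hp).mul (contDiffOn_fderiv_apply hU hp x)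

end IsAssociatedMinimalSurface

/-! ### The coefficients of the second component -/

/-- The coefficient `q⁻¹ q_u` of the system for the second component. -/
def secondU (ω : ℂ → ℝ) (p : ℂ → ℍ[ℝ]) (z : ℂ) : ℍ[ℝ] :=
  (1 / 2 : ℝ) • alpha2 p z - (1 / 2 * Real.exp (-1 * ω z)) • alpha3 p z
    + (1 / 8 * Real.exp (-1 * ω z) * dv ω z) • (alpha2 p z * alpha3 p z)

/-- The coefficient `q⁻¹ q_v` of the system for the second component. -/
def secondV (ω : ℂ → ℝ) (p : ℂ → ℍ[ℝ]) (z : ℂ) : ℍ[ℝ] :=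
  (1 / 2 : ℝ) • alpha3 p z - (1 / 2 * Real.exp (-1 * ω z)) • alpha2 p z
    - (1 / 8 * Real.exp (-1 * ω z) * du ω z) • (alpha2 p z * alpha3 p z)

/-- The unit normal, translated to the identity: `p̄ N`. The coefficient `q⁻¹ q_t` of the system for
the second component is `-(√3 / 2) p̄ N`. -/
def leftNormal (ω : ℂ → ℝ) (p : ℂ → ℍ[ℝ]) (z : ℂ) : ℍ[ℝ] :=
  (1 / 2 * Real.exp (-1 * ω z)) • (alpha2 p z * alpha3 p z)

namespace IsAssociatedMinimalSurface

variable {U : Set ℂ} {ω : ℂ → ℝ} {p : ℂ → ℍ[ℝ]} (hp : IsAssociatedMinimalSurface U ω p)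
  (hU : IsOpen U)

include hp hU

lemma contDiffOn_alpha2 : ContDiffOn ℝ (⊤ : ℕ∞) (alpha2 p) U :=
  contDiffOn_star_mul_fderiv hU hp.smooth 1

lemma contDiffOn_alpha3 : ContDiffOn ℝ (⊤ : ℕ∞) (alpha3 p) U :=
  contDiffOn_star_mul_fderiv hU hp.smooth Complex.I

lemma contDiffOn_secondU (hω : ContDiffOn ℝ (⊤ : ℕ∞) ω U) :
    ContDiffOn ℝ (⊤ : ℕ∞) (secondU ω p) U := by
  have h1 := hp.contDiffOn_alpha2 hU
  have h2 := hp.contDiffOn_alpha3 hU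
  have h3 := contDiffOn_dv hU hω
  unfold secondU
  fun_prop

lemma contDiffOn_secondV (hω : ContDiffOn ℝ (⊤ : ℕ∞) ω U) :
    ContDiffOn ℝ (⊤ : ℕ∞) (secondV ω p) U := by
  have h1 := hp.contDiffOn_alpha2 hU
  have h2 := hp.contDiffOn_alpha3 hU
  have h3 := contDiffOn_du hU hω
  unfold secondV
  fun_prop

lemma contDiffOn_leftNormal (hω : ContDiffOn ℝ (⊤ : ℕ∞) ω U) :
    ContDiffOn ℝ (⊤ : ℕ∞) (leftNormal ω p) U := by
  have h1 := hp.contDiffOn_alpha2 hU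
  have h2 := hp.contDiffOn_alpha3 hU
  unfold leftNormal
  fun_prop

lemma star_secondU {z : ℂ} (hz : z ∈ U) : star (secondU ω p z) = -secondU ω p z := by
  have h := hp.isImPair hU hz
  simp only [secondU, star_add, star_sub, star_smul, star_trivial, h.star_a, h.star_b, h.star_ab]
  module

lemma star_secondV {z : ℂ} (hz : z ∈ U) : star (secondV ω p z) = -secondV ω p z := by
  have h := hp.isImPair hU hz
  simp only [secondV, star_sub, star_smul, star_trivial, h.star_a, h.star_b, h.star_ab]
  module

lemma star_leftNormal {z : ℂ} (hz : z ∈ U) : star (leftNormal ω p z) = -leftNormal ω p z := by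
  have h := hp.isImPair hU hz
  simp only [leftNormal, star_smul, star_trivial, h.star_ab]
  module

lemma leftNormal_mul_self {z : ℂ} (hz : z ∈ U) : leftNormal ω p z * leftNormal ω p z = -1 := by
  have h := hp.isImPair hU hz
  have he := (Real.exp_pos (ω z)).ne'
  simp only [leftNormal, smul_mul_smul_comm, h.ab_ab, neg_one_mul, Real.exp_neg]
  match_scalars
  field_simp
  norm_num

lemma fderiv_alpha2_mul_alpha3 {z : ℂ} (hz : z ∈ U) (x : ℂ) :
    fderiv ℝ (fun w => alpha2 p w * alpha3 p w) z x =
      alpha2 p z * fderiv ℝ (alpha3 p) z x + fderiv ℝ (alpha2 p) z x * alpha3 p z := by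
  have d2 := (differentiableAt_of_contDiffOn hU (hp.contDiffOn_alpha2 hU) hz).hasFDerivAt
  have d3 := (differentiableAt_of_contDiffOn hU (hp.contDiffOn_alpha3 hU) hz).hasFDerivAt
  exact congrArg (fun T : ℂ →L[ℝ] ℍ[ℝ] => T x) (d2.mul' d3).fderiv

lemma du_alpha2_mul_alpha3 (hω : ContDiffOn ℝ (⊤ : ℕ∞) ω U) {z : ℂ} (hz : z ∈ U) :
    du (fun w => alpha2 p w * alpha3 p w) z = du ω z • (alpha2 p z * alpha3 p z)
      + (2 : ℝ) • alpha2 p z + (2 * Real.exp (ω z)) • alpha3 p z := by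
  have h := hp.isImPair hU hz
  have he := (Real.exp_pos (ω z)).ne'
  refine (hp.fderiv_alpha2_mul_alpha3 hU hz 1).trans ?_
  change alpha2 p z * du (alpha3 p) z + du (alpha2 p) z * alpha3 p z = _
  rw [hp.du_alpha2 hU hω hz, hp.du_alpha3 hU hω hz]
  simp only [mul_add, mul_sub, sub_mul, mul_smul_comm, smul_mul_assoc, h.aa, h.bb, h.a_ab, h.ab_b]
  match_scalars <;> field_simp <;> ring

lemma dv_alpha2_mul_alpha3 (hω : ContDiffOn ℝ (⊤ : ℕ∞) ω U) {z : ℂ} (hz : z ∈ U) :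
    dv (fun w => alpha2 p w * alpha3 p w) z = dv ω z • (alpha2 p z * alpha3 p z)
      - (2 * Real.exp (ω z)) • alpha2 p z - (2 : ℝ) • alpha3 p z := by
  have h := hp.isImPair hU hz
  have he := (Real.exp_pos (ω z)).ne'
  refine (hp.fderiv_alpha2_mul_alpha3 hU hz Complex.I).trans ?_
  change alpha2 p z * dv (alpha3 p) z + dv (alpha2 p) z * alpha3 p z = _
  rw [hp.dv_alpha2 hU hω hz, hp.dv_alpha3 hU hω hz]
  simp only [mul_add, add_mul, mul_smul_comm, smul_mul_assoc, h.aa, h.bb, h.a_ab, h.ab_b]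
  match_scalars <;> field_simp <;> ring

lemma fderiv_leftNormal (hω : ContDiffOn ℝ (⊤ : ℕ∞) ω U) {z : ℂ} (hz : z ∈ U) (x : ℂ) :
    fderiv ℝ (leftNormal ω p) z x =
      (1 / 2 * Real.exp (-1 * ω z)) • fderiv ℝ (fun w => alpha2 p w * alpha3 p w) z x
      - (1 / 2 * Real.exp (-1 * ω z) * fderiv ℝ ω z x) • (alpha2 p z * alpha3 p z) := by
  have hE := hasFDerivAt_exp_mul (differentiableAt_of_contDiffOn hU hω hz) (-1) (1 / 2)
  have hc := (differentiableAt_of_contDiffOn hU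
    ((hp.contDiffOn_alpha2 hU).mul (hp.contDiffOn_alpha3 hU)) hz).hasFDerivAt
  refine (congrArg (fun T : ℂ →L[ℝ] ℍ[ℝ] => T x) (hE.smul hc).fderiv).trans ?_
  simp only [add_apply, smul_apply, ContinuousLinearMap.smulRight_apply, smul_eq_mul]
  module

/-- The left-translated normal is parallel for the connection in the direction `u`. -/
lemma du_leftNormal (hω : ContDiffOn ℝ (⊤ : ℕ∞) ω U) {z : ℂ} (hz : z ∈ U) :
    du (leftNormal ω p) z =
      leftNormal ω p z * secondU ω p z - secondU ω p z * leftNormal ω p z := by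
  have h := hp.isImPair hU hz
  have he := (Real.exp_pos (ω z)).ne'
  refine (hp.fderiv_leftNormal hU hω hz 1).trans ?_
  change (1 / 2 * Real.exp (-1 * ω z)) • du (fun w => alpha2 p w * alpha3 p w) z
      - (1 / 2 * Real.exp (-1 * ω z) * du ω z) • (alpha2 p z * alpha3 p z) = _
  rw [hp.du_alpha2_mul_alpha3 hU hω hz]
  simp only [leftNormal, secondU, mul_add, add_mul, mul_sub, sub_mul, mul_smul_comm,
    smul_mul_assoc, h.a_ab, h.ab_b, h.b_ab, h.ab_a, h.ab_ab, neg_one_mul, Real.exp_neg]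
  match_scalars <;> field_simp <;> ring

lemma dv_leftNormal (hω : ContDiffOn ℝ (⊤ : ℕ∞) ω U) {z : ℂ} (hz : z ∈ U) :
    dv (leftNormal ω p) z =
      leftNormal ω p z * secondV ω p z - secondV ω p z * leftNormal ω p z := by
  have h := hp.isImPair hU hz
  have he := (Real.exp_pos (ω z)).ne'
  refine (hp.fderiv_leftNormal hU hω hz Complex.I).trans ?_
  change (1 / 2 * Real.exp (-1 * ω z)) • dv (fun w => alpha2 p w * alpha3 p w) z
      - (1 / 2 * Real.exp (-1 * ω z) * dv ω z) • (alpha2 p z * alpha3 p z) = _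
  rw [hp.dv_alpha2_mul_alpha3 hU hω hz]
  simp only [leftNormal, secondV, mul_sub, sub_mul, mul_smul_comm,
    smul_mul_assoc, h.a_ab, h.ab_b, h.b_ab, h.ab_a, h.ab_ab, neg_one_mul, Real.exp_neg]
  match_scalars <;> field_simp <;> ring

lemma dv_secondU (hω : ContDiffOn ℝ (⊤ : ℕ∞) ω U) {z : ℂ} (hz : z ∈ U) :
    dv (secondU ω p) z = (1 / 2 : ℝ) • dv (alpha2 p) z
      - (1 / 2 * Real.exp (-1 * ω z)) • dv (alpha3 p) z
      + (1 / 2 * Real.exp (-1 * ω z) * dv ω z) • alpha3 p z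
      + (1 / 8 * Real.exp (-1 * ω z) * dv ω z) • dv (fun w => alpha2 p w * alpha3 p w) z
      + (1 / 8 * Real.exp (-1 * ω z) * (dv (dv ω) z - dv ω z * dv ω z)) •
        (alpha2 p z * alpha3 p z) := by
  have dω := differentiableAt_of_contDiffOn hU hω hz
  have hE := hasFDerivAt_exp_mul dω (-1) (1 / 2)
  have hE' := hasFDerivAt_exp_mul dω (-1) (1 / 8)
  have hωv := (differentiableAt_of_contDiffOn hU (contDiffOn_dv hU hω) hz).hasFDerivAt
  have d2 := (differentiableAt_of_contDiffOn hU (hp.contDiffOn_alpha2 hU) hz).hasFDerivAt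
  have d3 := (differentiableAt_of_contDiffOn hU (hp.contDiffOn_alpha3 hU) hz).hasFDerivAt
  have hc := (differentiableAt_of_contDiffOn hU
    ((hp.contDiffOn_alpha2 hU).mul (hp.contDiffOn_alpha3 hU)) hz).hasFDerivAt
  have := ((d2.const_smul (1 / 2 : ℝ)).sub (hE.smul d3)).add ((hE'.mul hωv).smul hc)
  refine (congrArg (fun T : ℂ →L[ℝ] ℍ[ℝ] => T Complex.I) this.fderiv).trans ?_
  simp only [add_apply, sub_apply, smul_apply, ContinuousLinearMap.smulRight_apply, smul_eq_mul,
    Pi.mul_apply]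
  simp only [dv]
  module

lemma du_secondV (hω : ContDiffOn ℝ (⊤ : ℕ∞) ω U) {z : ℂ} (hz : z ∈ U) :
    du (secondV ω p) z = (1 / 2 : ℝ) • du (alpha3 p) z
      - (1 / 2 * Real.exp (-1 * ω z)) • du (alpha2 p) z
      + (1 / 2 * Real.exp (-1 * ω z) * du ω z) • alpha2 p z
      - (1 / 8 * Real.exp (-1 * ω z) * du ω z) • du (fun w => alpha2 p w * alpha3 p w) z
      - (1 / 8 * Real.exp (-1 * ω z) * (du (du ω) z - du ω z * du ω z)) •
        (alpha2 p z * alpha3 p z) := by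
  have dω := differentiableAt_of_contDiffOn hU hω hz
  have hE := hasFDerivAt_exp_mul dω (-1) (1 / 2)
  have hE' := hasFDerivAt_exp_mul dω (-1) (1 / 8)
  have hωu := (differentiableAt_of_contDiffOn hU (contDiffOn_du hU hω) hz).hasFDerivAt
  have d2 := (differentiableAt_of_contDiffOn hU (hp.contDiffOn_alpha2 hU) hz).hasFDerivAt
  have d3 := (differentiableAt_of_contDiffOn hU (hp.contDiffOn_alpha3 hU) hz).hasFDerivAt
  have hc := (differentiableAt_of_contDiffOn hU
    ((hp.contDiffOn_alpha2 hU).mul (hp.contDiffOn_alpha3 hU)) hz).hasFDerivAt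
  have := ((d3.const_smul (1 / 2 : ℝ)).sub (hE.smul d2)).sub ((hE'.mul hωu).smul hc)
  refine (congrArg (fun T : ℂ →L[ℝ] ℍ[ℝ] => T 1) this.fderiv).trans ?_
  simp only [add_apply, sub_apply, smul_apply, ContinuousLinearMap.smulRight_apply, smul_eq_mul,
    Pi.mul_apply]
  simp only [du]
  module

/-- The `(u, v)`-part of the system for the second component is flat. -/
lemma second_flat (hω : IsSinhGordonSolution U ω) {z : ℂ} (hz : z ∈ U) :
    du (secondV ω p) z - dv (secondU ω p) z
      + (secondU ω p z * secondV ω p z - secondV ω p z * secondU ω p z) = 0 := by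
  have h := hp.isImPair hU hz
  have he := (Real.exp_pos (ω z)).ne'
  have hl := hω.2 z hz
  rw [laplacian_eq_du_dv hU hω.1 hz, Real.sinh_eq, Real.exp_neg] at hl
  have hl' : du (du ω) z = -4 * (Real.exp (ω z) - (Real.exp (ω z))⁻¹) - dv (dv ω) z := by
    linear_combination hl
  rw [hp.du_secondV hU hω.1 hz, hp.dv_secondU hU hω.1 hz, hp.dv_alpha2_mul_alpha3 hU hω.1 hz,
    hp.du_alpha2_mul_alpha3 hU hω.1 hz, hp.du_alpha2 hU hω.1 hz, hp.du_alpha3 hU hω.1 hz,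
    hp.dv_alpha2 hU hω.1 hz, hp.dv_alpha3 hU hω.1 hz, hl']
  simp only [secondU, secondV, mul_add, add_mul, mul_sub, sub_mul, mul_smul_comm,
    smul_mul_assoc, h.aa, h.bb, h.ba, h.a_ab, h.ab_b, h.b_ab, h.ab_a, h.ab_ab, neg_one_mul,
    Real.exp_neg]
  match_scalars <;> field_simp <;> ring

end IsAssociatedMinimalSurface

/-! ### The system for the second component -/

/-- The one-form `a du + b dv + c dt` on `ℂ × ℝ`. -/
def threeForm (a b c : ℍ[ℝ]) : ℂ × ℝ →L[ℝ] ℍ[ℝ] :=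
  (oneForm a b).comp (.fst ℝ ℂ ℝ) + (ContinuousLinearMap.snd ℝ ℂ ℝ).smulRight c

lemma threeForm_apply (a b c : ℍ[ℝ]) (h : ℂ × ℝ) :
    threeForm a b c h = h.1.re • a + h.1.im • b + h.2 • c := rfl

/-- The one-form `q⁻¹ dq` prescribed for the second component. -/
def secondForm (ω : ℂ → ℝ) (p : ℂ → ℍ[ℝ]) (x : ℂ × ℝ) : ℂ × ℝ →L[ℝ] ℍ[ℝ] :=
  threeForm (secondU ω p x.1) (secondV ω p x.1) (-(√3 / 2) • leftNormal ω p x.1)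

lemma clm_apply_eq {V : Type*} [NormedAddCommGroup V] [NormedSpace ℝ V] (T : ℂ × ℝ →L[ℝ] V)
    (h : ℂ × ℝ) : T h = h.1.re • T (1, 0) + h.1.im • T (Complex.I, 0) + h.2 • T (0, 1) := by
  rw [← map_smul, ← map_smul, ← map_smul, ← map_add, ← map_add]
  congr 1
  ext <;> simp

lemma cos_sub_sin_mul_star {n : ℍ[ℝ]} (hs : star n = -n) (hn : n * n = -1) (θ : ℝ) :
    (Real.cos θ • 1 - Real.sin θ • n) * star (Real.cos θ • 1 - Real.sin θ • n) = 1 := by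
  have := Real.sin_sq_add_cos_sq θ
  simp only [star_sub, star_smul, star_one, star_trivial, hs, mul_sub, sub_mul, smul_mul_assoc,
    mul_smul_comm, one_mul, mul_one, mul_neg, hn, smul_neg]
  match_scalars
  · linear_combination this
  · ring

namespace IsAssociatedMinimalSurface

variable {U : Set ℂ} {ω : ℂ → ℝ} {p : ℂ → ℍ[ℝ]} (hp : IsAssociatedMinimalSurface U ω p)
  (hU : IsOpen U)

include hp hU

lemma star_secondForm (x : ℂ × ℝ) (hx : x ∈ U ×ˢ (univ : Set ℝ)) (h : ℂ × ℝ) :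
    star (secondForm ω p x h) = -secondForm ω p x h := by
  simp only [secondForm, threeForm_apply, star_add, star_smul, star_trivial,
    hp.star_secondU hU hx.1, hp.star_secondV hU hx.1, hp.star_leftNormal hU hx.1]
  module

lemma contDiffOn_secondForm (hω : ContDiffOn ℝ (⊤ : ℕ∞) ω U) :
    ContDiffOn ℝ (⊤ : ℕ∞) (secondForm ω p) (U ×ˢ (univ : Set ℝ)) := by
  have hf : ∀ {f : ℂ → ℍ[ℝ]}, ContDiffOn ℝ (⊤ : ℕ∞) f U →
      ContDiffOn ℝ (⊤ : ℕ∞) (fun x : ℂ × ℝ => f x.1) (U ×ˢ (univ : Set ℝ)) := fun h =>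
    h.comp contDiffOn_fst fun x hx => hx.1
  have h1 := hf (hp.contDiffOn_secondU hU hω)
  have h2 := hf (hp.contDiffOn_secondV hU hω)
  have h3 := hf (hp.contDiffOn_leftNormal hU hω)
  unfold secondForm threeForm oneForm
  exact ((((contDiffOn_const.smulRight h1).add (contDiffOn_const.smulRight h2)).clm_comp
    contDiffOn_const)).add (contDiffOn_const.smulRight (h3.const_smul (-(√3 / 2))))

/-- The system for the second component, written as `dq = q A`. -/
theorem isSecondComponent_iff (hω : ContDiffOn ℝ (⊤ : ℕ∞) ω U) {q : ℂ × ℝ → ℍ[ℝ]} :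
    IsSecondComponent U ω p q ↔ ∀ x ∈ U ×ˢ (univ : Set ℝ), ‖q x‖ = 1 ∧
      HasFDerivAt q (leftMulForm (q x) (secondForm ω p x)) x := by
  have hU' : IsOpen (U ×ˢ (univ : Set ℝ)) := hU.prod isOpen_univ
  have et : ∀ z ∈ U, ∀ t : ℝ, leftMulForm (q (z, t)) (secondForm ω p (z, t)) (0, 1) =
      -((√3 * Real.exp (-ω z) / 4) • (q (z, t) * cross (alpha2 p z) (alpha3 p z))) := by
    intro z hz t
    rw [(hp.isImPair hU hz).cross_eq]
    simp only [leftMulForm_apply, secondForm, threeForm_apply, leftNormal, Complex.zero_re,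
      Complex.zero_im, mul_add, mul_smul_comm, neg_one_mul]
    module
  have eu : ∀ z ∈ U, ∀ t : ℝ, leftMulForm (q (z, t)) (secondForm ω p (z, t)) (1, 0) =
      (Real.exp (-ω z) / 8) •
      ((4 * Real.exp (ω z)) • (q (z, t) * alpha2 p z) - (4 : ℝ) • (q (z, t) * alpha3 p z)
        + dv ω z • (q (z, t) * cross (alpha2 p z) (alpha3 p z))) := by
    intro z hz t
    have he := (Real.exp_pos (ω z)).ne'
    rw [(hp.isImPair hU hz).cross_eq]
    simp only [leftMulForm_apply, secondForm, threeForm_apply, secondU, Complex.one_re,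
      Complex.one_im, mul_add, mul_sub, mul_smul_comm, neg_one_mul, Real.exp_neg]
    match_scalars <;> field_simp <;> ring
  have ev : ∀ z ∈ U, ∀ t : ℝ, leftMulForm (q (z, t)) (secondForm ω p (z, t)) (Complex.I, 0) =
      -((Real.exp (-ω z) / 8) •
      ((4 : ℝ) • (q (z, t) * alpha2 p z) - (4 * Real.exp (ω z)) • (q (z, t) * alpha3 p z)
        + du ω z • (q (z, t) * cross (alpha2 p z) (alpha3 p z)))) := by
    intro z hz t
    have he := (Real.exp_pos (ω z)).ne'
    rw [(hp.isImPair hU hz).cross_eq]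
    simp only [leftMulForm_apply, secondForm, threeForm_apply, secondV, Complex.I_re,
      Complex.I_im, mul_add, mul_sub, mul_smul_comm, neg_one_mul, Real.exp_neg]
    match_scalars <;> field_simp <;> ring
  constructor
  · rintro hq ⟨z, t⟩ hx
    refine ⟨hq.mem_sphere z hx.1 t, ?_⟩
    have hd := (differentiableAt_of_contDiffOn hU' hq.smooth hx).hasFDerivAt
    convert! hd using 1
    refine ContinuousLinearMap.ext fun h => ?_
    rw [clm_apply_eq, clm_apply_eq (fderiv ℝ q (z, t)), hq.dq_u z hx.1 t, hq.dq_v z hx.1 t,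
      hq.dq_t z hx.1 t, et z hx.1 t, eu z hx.1 t, ev z hx.1 t]
  · intro hq
    refine ⟨contDiffOn_solution hU' (hp.contDiffOn_secondForm hU hω) fun x hx => (hq x hx).2,
      fun z hz t => (hq (z, t) ⟨hz, trivial⟩).1, fun z hz t => ?_, fun z hz t => ?_,
      fun z hz t => ?_⟩ <;> rw [(hq (z, t) ⟨hz, trivial⟩).2.fderiv]
    exacts [et z hz t, eu z hz t, ev z hz t]

/-- Along the lines in the direction `t` the solution is a geodesic of the sphere in the direction
of the left-translated normal, which is parallel; so a solution of the `(u, v)`-part of the system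
extends explicitly to all times. -/
theorem exists_isSecondComponent (hUsc : IsSimplyConnected U) (hω : IsSinhGordonSolution U ω)
    {z₀ : ℂ} (hz₀ : z₀ ∈ U) (t₀ : ℝ) {q₀ : ℍ[ℝ]} (hq₀ : ‖q₀‖ = 1) :
    ∃ q : ℂ × ℝ → ℍ[ℝ], IsSecondComponent U ω p q ∧ q (z₀, t₀) = q₀ := by
  obtain ⟨F, -, hF0, hFn, hF⟩ := exists_solution hU hUsc (hp.contDiffOn_secondU hU hω.1)
    (hp.contDiffOn_secondV hU hω.1) (fun z hz => hp.star_secondU hU hz)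
    (fun z hz => hp.star_secondV hU hz) (fun z hz => hp.second_flat hU hω hz) hz₀ hq₀
  refine ⟨fun x => F x.1 * (Real.cos (√3 / 2 * (x.2 - t₀)) • 1
    - Real.sin (√3 / 2 * (x.2 - t₀)) • leftNormal ω p x.1), ?_, ?_⟩
  · rw [hp.isSecondComponent_iff hU hω.1]
    rintro ⟨z, t⟩ ⟨hz, -⟩
    replace hz : z ∈ U := hz
    have hn := hp.leftNormal_mul_self hU hz
    constructor
    · refine norm_eq_one_of_mul_star ?_
      have hX := cos_sub_sin_mul_star (hp.star_leftNormal hU hz) hn (√3 / 2 * (t - t₀))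
      rw [star_mul, mul_assoc, ← mul_assoc (_ - _), hX, one_mul, mul_star_self_of_norm (hFn z hz)]
    · have dn := (differentiableAt_of_contDiffOn hU (hp.contDiffOn_leftNormal hU hω.1)
        hz).hasFDerivAt
      have dF' : HasFDerivAt (fun x : ℂ × ℝ => F x.1) _ (z, t) :=
        HasFDerivAt.comp (z, t) (hF z hz) hasFDerivAt_fst
      have dn' : HasFDerivAt (fun x : ℂ × ℝ => leftNormal ω p x.1) _ (z, t) :=
        HasFDerivAt.comp (g := leftNormal ω p) (f := Prod.fst) (z, t) dn hasFDerivAt_fst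
      have dθ : HasFDerivAt (fun x : ℂ × ℝ => √3 / 2 * (x.2 - t₀))
          ((√3 / 2) • ContinuousLinearMap.snd ℝ ℂ ℝ) (z, t) :=
        (hasFDerivAt_snd.sub_const t₀).const_mul _
      have := dF'.mul' ((dθ.cos.smul_const (1 : ℍ[ℝ])).sub (dθ.sin.smul dn'))
      convert! this using 1
      refine ContinuousLinearMap.ext fun h => ?_
      have hnu := hp.du_leftNormal hU hω.1 hz
      have hnv := hp.dv_leftNormal hU hω.1 hz
      simp only [leftMulForm_apply, secondForm, threeForm_apply, add_apply, sub_apply, smul_apply,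
        ContinuousLinearMap.comp_apply, ContinuousLinearMap.smulRight_apply,
        ContinuousLinearMap.coe_fst', ContinuousLinearMap.coe_snd', oneForm_apply,
        fderiv_eq_du_dv, hnu, hnv, MulOpposite.smul_eq_mul_unop, MulOpposite.unop_op, smul_eq_mul,
        Pi.sub_apply, Pi.smul_apply']
      generalize leftNormal ω p z = n at *
      generalize √3 / 2 * (t - t₀) = θ at *
      have hn' : ∀ x, n * (n * x) = -x := fun x => by rw [← mul_assoc, hn, neg_one_mul]
      simp only [mul_add, add_mul, mul_sub, sub_mul, smul_mul_assoc, mul_smul_comm, mul_one,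
        mul_assoc, smul_add, smul_sub, hn, mul_neg]
      module
  · simp [hF0]

lemma eqOn_of_isSecondComponent (hUsc : IsSimplyConnected U) (hω : ContDiffOn ℝ (⊤ : ℕ∞) ω U)
    {q q' : ℂ × ℝ → ℍ[ℝ]} (hq : IsSecondComponent U ω p q) (hq' : IsSecondComponent U ω p q')
    {z₀ : ℂ} (hz₀ : z₀ ∈ U) {t₀ : ℝ} (h0 : q' (z₀, t₀) = q (z₀, t₀)) :
    EqOn q' q (U ×ˢ univ) := by
  rw [hp.isSecondComponent_iff hU hω] at hq hq'
  intro x hx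
  have hx₀ : (z₀, t₀) ∈ U ×ˢ (univ : Set ℝ) := ⟨hz₀, trivial⟩
  have := mul_star_eq_of_solutions (hU.prod isOpen_univ)
    (hUsc.isPathConnected.isConnected.isPreconnected.prod isPreconnected_univ)
    (hp.star_secondForm hU) (fun y hy => (hq' y hy).2) (fun y hy => (hq y hy).2) hx hx₀
  rw [h0, mul_star_self_of_norm (hq _ hx₀).1] at this
  have h1 := congrArg (· * q x) this
  simpa [mul_assoc, star_mul_self_of_norm (hq x hx).1] using h1

end IsAssociatedMinimalSurface

/-! ### The Lagrangian property -/

/-- The almost complex structure in the left trivialization of the tangent bundle. -/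
lemma J_mul {p q : ℍ[ℝ]} (hp : ‖p‖ = 1) (hq : ‖q‖ = 1) (X Y : ℍ[ℝ]) :
    J (p, q) (p * X, q * Y) =
      (p * ((1 / √3 : ℝ) • ((2 : ℝ) • Y - X)), q * ((1 / √3 : ℝ) • (Y - (2 : ℝ) • X))) := by
  have hp0 : p ≠ 0 := norm_ne_zero_iff.1 (by rw [hp]; exact one_ne_zero)
  have hq0 : q ≠ 0 := norm_ne_zero_iff.1 (by rw [hq]; exact one_ne_zero)
  unfold J
  simp only [mul_assoc, inv_mul_cancel_left₀ hp0, inv_mul_cancel_left₀ hq0, mul_smul_comm, mul_sub,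
    Prod.smul_mk]
  congr 2
  abel

/-- The Kähler form in the left trivialization of the tangent bundle. -/
lemma g_J_mul {p q : ℍ[ℝ]} (hp : ‖p‖ = 1) (hq : ‖q‖ = 1) (X Y X' Y' : ℍ[ℝ]) :
    g (p, q) (J (p, q) (p * X, q * Y)) (p * X', q * Y') =
      2 / √3 * (inner ℝ Y X' - inner ℝ X Y') := by
  have h3 : √3 * √3 = 3 := Real.mul_self_sqrt (by norm_num)
  have h0 : √3 ≠ 0 := by positivity
  unfold g
  rw [J_mul hp hq, J_mul hp hq, J_mul hp hq]
  simp only [euclid, inner_mul_left_of_norm hp, inner_mul_left_of_norm hq, inner_sub_left,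
    inner_sub_right, real_inner_smul_left, real_inner_smul_right]
  field_simp
  rw [show √3 ^ 2 = 3 from by rw [sq, h3]]
  ring

namespace IsAssociatedMinimalSurface

variable {U : Set ℂ} {ω : ℂ → ℝ} {p : ℂ → ℍ[ℝ]} (hp : IsAssociatedMinimalSurface U ω p)
  (hU : IsOpen U)

include hp hU

omit hU in
lemma fderiv_eq_mul_oneForm {z : ℂ} (hz : z ∈ U) (h : ℂ) :
    fderiv ℝ p z h = p z * oneForm (alpha2 p z) (alpha3 p z) h := by
  rw [fderiv_eq_du_dv, oneForm_apply]
  simp only [alpha2, alpha3, mul_add, mul_smul_comm, hp.p_mul_star_mul hz]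

/-- The Kähler form vanishes on the tangent spaces because `⟨A X, α Y⟩` is symmetric in `X` and `Y`,
where `A = q̄ dq` and `α = p̄ dp`. -/
lemma inner_secondForm_symm {z : ℂ} (hz : z ∈ U) (t : ℝ) (X Y : ℂ × ℝ) :
    inner ℝ (secondForm ω p (z, t) X) (oneForm (alpha2 p z) (alpha3 p z) Y.1) =
      inner ℝ (oneForm (alpha2 p z) (alpha3 p z) X.1) (secondForm ω p (z, t) Y) := by
  have h := hp.isImPair hU hz
  simp only [secondForm, threeForm_apply, oneForm_apply, secondU, secondV, leftNormal,
    inner_add_left, inner_add_right, inner_sub_left, inner_sub_right, real_inner_smul_left,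
    real_inner_smul_right, h.inner_aa, h.inner_bb, h.inner_ab, h.inner_a_ab, h.inner_b_ab,
    real_inner_comm (alpha2 p z) (alpha3 p z), real_inner_comm (alpha2 p z) (_ * _),
    real_inner_comm (alpha3 p z) (_ * _)]
  ring

theorem isLagrangianImmersion (hω : ContDiffOn ℝ (⊤ : ℕ∞) ω U) {q : ℂ × ℝ → ℍ[ℝ]}
    (hq : IsSecondComponent U ω p q) :
    IsLagrangianImmersion (U ×ˢ univ) (fun x => (p x.1, q x)) := by
  have hq' := (hp.isSecondComponent_iff hU hω).1 hq
  have hd : ∀ x ∈ U ×ˢ (univ : Set ℝ), ∀ X, fderiv ℝ (fun x : ℂ × ℝ => (p x.1, q x)) x X =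
      (p x.1 * oneForm (alpha2 p x.1) (alpha3 p x.1) X.1, q x * secondForm ω p x X) := by
    intro x hx X
    have dp := (differentiableAt_of_contDiffOn hU hp.smooth hx.1).hasFDerivAt
    have dp' : HasFDerivAt (fun x : ℂ × ℝ => p x.1) _ x :=
      HasFDerivAt.comp (g := p) (f := Prod.fst) x dp hasFDerivAt_fst
    rw [(dp'.prodMk (hq' x hx).2).fderiv, ← hp.fderiv_eq_mul_oneForm hx.1]
    rfl
  refine ⟨(hp.smooth.comp contDiffOn_fst fun x hx => hx.1).prodMk hq.smooth,
    fun x hx => ⟨hp.mem_sphere _ hx.1, (hq' x hx).1⟩, fun x hx => ?_, fun x hx X Y => ?_⟩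
  · rw [injective_iff_map_eq_zero]
    intro X hX
    have h := hp.isImPair hU hx.1
    rw [hd x hx, Prod.mk_eq_zero] at hX
    have hne : ∀ {y : ℍ[ℝ]}, ‖y‖ = 1 → y ≠ 0 := fun hy =>
      norm_ne_zero_iff.1 (by rw [hy]; exact one_ne_zero)
    have h1 := (mul_eq_zero.1 hX.1).resolve_left (hne (hp.mem_sphere _ hx.1))
    have h2 := (mul_eq_zero.1 hX.2).resolve_left (hne (hq' x hx).1)
    have hpos := h.pos
    have e1 := congrArg (fun y => inner ℝ y (alpha2 p x.1)) h1
    have e2 := congrArg (fun y => inner ℝ y (alpha3 p x.1)) h1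
    simp only [oneForm_apply, inner_add_left, real_inner_smul_left, h.inner_aa, h.inner_bb,
      h.inner_ab, real_inner_comm (alpha2 p x.1) (alpha3 p x.1), inner_zero_left, mul_zero,
      add_zero, zero_add] at e1 e2
    have r1 := (mul_eq_zero.1 e1).resolve_right (by positivity)
    have r2 := (mul_eq_zero.1 e2).resolve_right (by positivity)
    simp only [secondForm, threeForm_apply, r1, r2, zero_smul, zero_add] at h2
    have hn : leftNormal ω p x.1 ≠ 0 := fun h0 => by
      have := hp.leftNormal_mul_self hU hx.1
      simp [h0] at this
    have r3 := (smul_eq_zero.1 h2).resolve_right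
      (smul_ne_zero (neg_ne_zero.2 (by positivity)) hn)
    exact Prod.ext (Complex.ext r1 r2) r3
  · rw [hd x hx, hd x hx, g_J_mul (hp.mem_sphere _ hx.1) (hq' x hx).1]
    rw [show secondForm ω p x = secondForm ω p (x.1, x.2) from rfl,
      hp.inner_secondForm_symm hU hx.1, sub_self, mul_zero]

end IsAssociatedMinimalSurface

/-! ### The flat torus -/

/-- The one-parameter group `cos θ + i sin θ`. -/
def rotI (θ : ℝ) : ℍ[ℝ] := Real.cos θ • 1 + Real.sin θ • qi

/-- The one-parameter group `cos θ + j sin θ`. -/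
def rotJ (θ : ℝ) : ℍ[ℝ] := Real.cos θ • 1 + Real.sin θ • qj

/-- The conjugate of `i` by `cos θ + j sin θ`. -/
def conjI (θ : ℝ) : ℍ[ℝ] := Real.cos (2 * θ) • qi + Real.sin (2 * θ) • qk

lemma qi_mul_rotJ (θ : ℝ) : qi * rotJ θ = rotJ θ * conjI θ := by
  have h := Real.sin_sq_add_cos_sq θ
  simp only [rotJ, conjI, Real.cos_two_mul', Real.sin_two_mul]
  ext <;> simp
  · linear_combination (-Real.cos θ) * h
  · linear_combination (-Real.sin θ) * h

lemma norm_rotI (θ : ℝ) : ‖rotI θ‖ = 1 := by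
  refine norm_eq_one_of_mul_star ?_
  have h := Real.sin_sq_add_cos_sq θ
  ext <;> simp [rotI] <;> linarith

lemma norm_rotJ (θ : ℝ) : ‖rotJ θ‖ = 1 := by
  refine norm_eq_one_of_mul_star ?_
  have h := Real.sin_sq_add_cos_sq θ
  ext <;> simp [rotJ] <;> linarith

lemma hasDerivAt_rotI (θ : ℝ) : HasDerivAt rotI (rotI θ * qi) θ := by
  have := ((Real.hasDerivAt_cos θ).smul_const (1 : ℍ[ℝ])).add
    ((Real.hasDerivAt_sin θ).smul_const qi)
  convert! this using 1
  ext <;> simp [rotI]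

lemma hasDerivAt_rotJ (θ : ℝ) : HasDerivAt rotJ (rotJ θ * qj) θ := by
  have := ((Real.hasDerivAt_cos θ).smul_const (1 : ℍ[ℝ])).add
    ((Real.hasDerivAt_sin θ).smul_const qj)
  convert! this using 1
  ext <;> simp [rotJ]

lemma star_conjI (θ : ℝ) : star (conjI θ) = -conjI θ := by ext <;> simp [conjI]

lemma hasDerivAt_conjI (θ : ℝ) : HasDerivAt conjI ((2 : ℝ) • (conjI θ * qj)) θ := by
  have h2 : HasDerivAt (fun θ : ℝ => 2 * θ) 2 θ := by simpa using (hasDerivAt_id θ).const_mul 2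
  have := (h2.cos.smul_const qi).add (h2.sin.smul_const qk)
  convert! this using 1
  ext <;> simp [conjI] <;> ring

lemma flatTorusP_eq (u w : ℝ) : flatTorusP u w = rotI w * rotJ u := by
  ext <;> simp [flatTorusP, rotI, rotJ, mul_comm]

lemma flatTorusQ_eq (u v : ℝ) : flatTorusQ u v = rotI v * rotJ (u - Real.pi / 4) := by
  have hs : √2 ≠ 0 := by positivity
  have h2 : √2 * √2 = 2 := Real.mul_self_sqrt (by norm_num)
  have h3 : (1 / √2 : ℝ) = √2 / 2 := by field_simp; linarith
  unfold flatTorusQ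
  rw [h3]
  have e1 : Real.cos (u - Real.pi / 4) = √2 / 2 * (Real.sin u + Real.cos u) := by
    rw [Real.cos_sub, Real.cos_pi_div_four, Real.sin_pi_div_four]; ring
  have e2 : Real.sin (u - Real.pi / 4) = √2 / 2 * (Real.sin u - Real.cos u) := by
    rw [Real.sin_sub, Real.cos_pi_div_four, Real.sin_pi_div_four]; ring
  unfold rotI rotJ
  rw [e1, e2]
  ext
  · refine (Quaternion.re_smul _ _).trans ?_
    simp; ring
  · refine (Quaternion.imI_smul _ _).trans ?_
    simp; ring
  · refine (Quaternion.imJ_smul _ _).trans ?_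
    simp; ring
  · refine (Quaternion.imK_smul _ _).trans ?_
    simp; ring

/-- Both components of the flat torus are of the form `e^{iV} e^{jW}`, whose left-translated
differential is `conj(i) dV + j dW`. -/
lemma hasFDerivAt_rotI_mul_rotJ {E : Type*} [NormedAddCommGroup E] [NormedSpace ℝ E]
    {V W : E → ℝ} {V' W' : E →L[ℝ] ℝ} {x : E} (hV : HasFDerivAt V V' x) (hW : HasFDerivAt W W' x)
    {A : E →L[ℝ] ℍ[ℝ]} (hA : ∀ h, A h = V' h • conjI (W x) + W' h • qj) :
    HasFDerivAt (fun y => rotI (V y) * rotJ (W y)) (leftMulForm (rotI (V x) * rotJ (W x)) A) x := by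
  have h1 := (hasDerivAt_rotI (V x)).hasFDerivAt.comp x hV
  have h2 := (hasDerivAt_rotJ (W x)).hasFDerivAt.comp x hW
  convert! h1.mul' h2 using 1
  refine ContinuousLinearMap.ext fun h => ?_
  simp only [leftMulForm_apply, hA, add_apply, smul_apply, ContinuousLinearMap.comp_apply,
    ContinuousLinearMap.toSpanSingleton_apply, MulOpposite.smul_eq_mul_unop, MulOpposite.unop_op,
    smul_eq_mul, Function.comp_apply, mul_add, mul_smul_comm, smul_mul_assoc, mul_assoc,
    qi_mul_rotJ]
  abel

/-- Two pairs of orthonormal imaginary quaternions are conjugate. A conjugating quaternion is found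
by averaging an arbitrary quaternion over the action of the quaternion group. -/
lemma exists_conj {x y x' y' : ℍ[ℝ]} (h : IsImPair x y (1 / 2)) (h' : IsImPair x' y' (1 / 2)) :
    ∃ c : ℍ[ℝ], ‖c‖ = 1 ∧ x * c = c * x' ∧ y * c = c * y' := by
  -- the sum of `g v g'⁻¹` over the corresponding elements `1, x, y, xy` and `1, x', y', x'y'`; such
  -- a sum intertwines the two pairs
  set T : ℍ[ℝ] → ℍ[ℝ] := fun v => v - x * v * x' - y * v * y' - (x * y) * v * (x' * y') with hT
  have hone : ((2 : ℝ) * (1 / 2)) • (1 : ℍ[ℝ]) = 1 := by norm_num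
  have hx : x * x = -1 := by rw [h.aa, hone]
  have hy : y * y = -1 := by rw [h.bb, hone]
  have hx' : x' * x' = -1 := by rw [h'.aa, hone]
  have hy' : y' * y' = -1 := by rw [h'.bb, hone]
  have kx : ∀ w, x * (x * w) = -w := fun w => by rw [← mul_assoc, hx, neg_one_mul]
  have ky : ∀ w, y * (y * w) = -w := fun w => by rw [← mul_assoc, hy, neg_one_mul]
  have kyx : ∀ w, y * (x * w) = -(x * (y * w)) := fun w => by
    rw [← mul_assoc, h.ba, neg_mul, mul_assoc]
  have kx' : ∀ w, x' * (x' * w) = -w := fun w => by rw [← mul_assoc, hx', neg_one_mul]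
  have hTx : ∀ v, x * T v = T v * x' := by
    intro v
    simp only [hT, mul_sub, sub_mul, mul_assoc, kx, hx', h'.ba, mul_neg, kx']
    noncomm_ring
  have hTy : ∀ v, y * T v = T v * y' := by
    intro v
    simp only [hT, mul_sub, sub_mul, mul_assoc, ky, kyx, hy', mul_neg]
    noncomm_ring
  -- the sum of `g w g⁻¹` over `g = 1, i, j, k` is `4 re w`, so it vanishes for imaginary `w`
  have hre : ∀ {w : ℍ[ℝ]}, star w = -w → ∀ s : ℍ[ℝ],
      s * w * 1 + s * (qi * (w * star qi)) + s * (qj * (w * star qj))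
        + s * (qk * (w * star qk)) = 0 := by
    intro w hw s
    have h0 : w.re = 0 := by
      have := congrArg (fun q : ℍ[ℝ] => q.re) hw
      simp at this
      linarith
    have : w * 1 + qi * (w * star qi) + qj * (w * star qj) + qk * (w * star qk) = 0 := by
      ext <;> simp [h0]
    rw [mul_assoc, ← mul_add, ← mul_add, ← mul_add, this, mul_zero]
  -- the trace-like sum of `T` over the standard basis is non-zero, so `T` does not vanish
  have hsum : T 1 * 1 + T qi * star qi + T qj * star qj + T qk * star qk = (4 : ℝ) • 1 := by
    have e1 := hre h'.star_a x
    have e2 := hre h'.star_b y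
    have e3 := hre h'.star_ab (x * y)
    -- only the summand of `g = 1` contributes
    have e4 : (1 : ℍ[ℝ]) + qi * star qi + qj * star qj + qk * star qk = (4 : ℝ) • 1 := by
      ext <;> norm_num
    calc _ = ((1 : ℍ[ℝ]) + qi * star qi + qj * star qj + qk * star qk)
          - (x * x' * 1 + x * (qi * (x' * star qi)) + x * (qj * (x' * star qj))
            + x * (qk * (x' * star qk)))
          - (y * y' * 1 + y * (qi * (y' * star qi)) + y * (qj * (y' * star qj))
            + y * (qk * (y' * star qk)))
          - (x * y * (x' * y') * 1 + x * y * (qi * (x' * y' * star qi))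
            + x * y * (qj * (x' * y' * star qj)) + x * y * (qk * (x' * y' * star qk))) := by
            simp only [hT, sub_mul, mul_assoc, mul_one, one_mul]
            abel
      _ = _ := by rw [e1, e2, e3, e4]; simp
  have hex : ∃ v, T v ≠ 0 := by
    by_contra! hall
    rw [hall, hall, hall, hall] at hsum
    have := congrArg (fun q : ℍ[ℝ] => q.re) hsum
    simp at this
  obtain ⟨v, hv⟩ := hex
  refine ⟨‖T v‖⁻¹ • T v, ?_, ?_, ?_⟩
  · rw [norm_smul, norm_inv, norm_norm, inv_mul_cancel₀ (norm_ne_zero_iff.2 hv)]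
  · rw [mul_smul_comm, smul_mul_assoc, hTx]
  · rw [mul_smul_comm, smul_mul_assoc, hTy]

/-! ### Rigidity in the flat case -/

lemma isImPair_conjI_qj (θ : ℝ) : IsImPair (conjI θ) qj (1 / 2) := by
  have h := Real.sin_sq_add_cos_sq (2 * θ)
  refine ⟨by norm_num, star_conjI θ, by ext <;> simp, ?_, ?_, ?_⟩
  · ext <;> simp [conjI] <;> linarith
  · ext <;> simp
  · ext <;> simp [conjI]

lemma conjI_sub_pi_div_four (θ : ℝ) : conjI (θ - Real.pi / 4) = -(conjI θ * qj) := by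
  have h : 2 * (θ - Real.pi / 4) = 2 * θ - Real.pi / 2 := by ring
  unfold conjI
  rw [h, Real.cos_sub_pi_div_two, Real.sin_sub_pi_div_two]
  ext <;> simp

/-- If `F` solves `dF = F A`, `G` solves `dG = G B`, and the imaginary forms `A` and `B` are
conjugate by the constant `c`, then `F = a G c⁻¹` for a constant `a`. -/
lemma exists_eq_mul_mul_inv {E : Type*} [NormedAddCommGroup E] [NormedSpace ℝ E] {s : Set E}
    (hs : IsOpen s) (hc : IsPreconnected s) (hne : s.Nonempty) {A B : E → E →L[ℝ] ℍ[ℝ]}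
    {F G : E → ℍ[ℝ]} (hF : ∀ z ∈ s, HasFDerivAt F (leftMulForm (F z) (A z)) z)
    (hG : ∀ z ∈ s, HasFDerivAt G (leftMulForm (G z) (B z)) z) (hFn : ∀ z ∈ s, ‖F z‖ = 1)
    (hGn : ∀ z ∈ s, ‖G z‖ = 1) (hB : ∀ z ∈ s, ∀ h, star (B z h) = -B z h) {c : ℍ[ℝ]}
    (hcn : ‖c‖ = 1) (hAB : ∀ z ∈ s, ∀ h, A z h * c = c * B z h) :
    ∃ a : ℍ[ℝ], ‖a‖ = 1 ∧ ∀ z ∈ s, F z = a * G z * c⁻¹ := by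
  have hc0 : c ≠ 0 := norm_ne_zero_iff.1 (by rw [hcn]; exact one_ne_zero)
  obtain ⟨z₀, hz₀⟩ := hne
  have hFc : ∀ z ∈ s, HasFDerivAt (fun z => F z * c) (leftMulForm (F z * c) (B z)) z := by
    intro z hz
    convert! (hF z hz).mul_const' c using 1
    refine ContinuousLinearMap.ext fun h => ?_
    simp only [leftMulForm_apply, smul_apply, MulOpposite.smul_eq_mul_unop, MulOpposite.unop_op,
      mul_assoc, hAB z hz]
  refine ⟨F z₀ * c * star (G z₀), by simp [hFn z₀ hz₀, hGn z₀ hz₀, hcn], fun z hz => ?_⟩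
  rw [← mul_star_eq_of_solutions hs hc hB hFc hG hz hz₀, mul_assoc _ (star _),
    star_mul_self_of_norm (hGn z hz), mul_one, mul_assoc, mul_inv_cancel₀ hc0, mul_one]

namespace IsAssociatedMinimalSurface

variable {U : Set ℂ} {ω : ℂ → ℝ} {p : ℂ → ℍ[ℝ]} (hp : IsAssociatedMinimalSurface U ω p)
  (hU : IsOpen U)

include hp hU

/-- For `ω = 0`, the frame `α₂, α₃` agrees with the frame of the flat torus up to conjugation. The
frame `α₂ - α₃` is constant, and the frame `α₂ + α₃, α₂ × α₃` rotates like the one of the flat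
torus; so a conjugation which matches the frames at one point matches them everywhere. -/
lemma exists_conj_frame (hUc : IsPreconnected U) (hω : ContDiffOn ℝ (⊤ : ℕ∞) ω U)
    (h0 : ∀ z ∈ U, ω z = 0) {z₀ : ℂ} (hz₀ : z₀ ∈ U) : ∃ c : ℍ[ℝ], ‖c‖ = 1 ∧ ∀ z ∈ U,
      alpha2 p z * c = c * (conjI (z.re - z.im) + qj) ∧
      alpha3 p z * c = c * (conjI (z.re - z.im) - qj) ∧
      alpha2 p z * alpha3 p z * c = -((2 : ℝ) • (c * (conjI (z.re - z.im) * qj))) := by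
  have hdω : ∀ z ∈ U, du ω z = 0 ∧ dv ω z = 0 := by
    intro z hz
    have : ω =ᶠ[𝓝 z] fun _ => 0 := by filter_upwards [hU.mem_nhds hz] with w hw using h0 w hw
    simp [du, dv, this.fderiv_eq]
  set m : ℂ → ℍ[ℝ] := fun z => (1 / 2 : ℝ) • (alpha2 p z + alpha3 p z) with hm
  set j : ℂ → ℍ[ℝ] := fun z => (1 / 2 : ℝ) • (alpha2 p z - alpha3 p z) with hj
  set n : ℂ → ℍ[ℝ] := fun z => (1 / 2 : ℝ) • (alpha2 p z * alpha3 p z) with hn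
  have hpair : ∀ z ∈ U, IsImPair (m z) (j z) (1 / 2) := by
    intro z hz
    have h := hp.isImPair hU hz
    rw [h0 z hz, Real.exp_zero] at h
    constructor
    · norm_num
    · simp only [hm, star_smul, star_add, h.star_a, h.star_b, star_trivial]; module
    · simp only [hj, star_smul, star_sub, h.star_a, h.star_b, star_trivial]; module
    · simp only [hm, smul_mul_smul_comm, add_mul, mul_add, h.aa, h.bb, h.ba]; module
    · simp only [hj, smul_mul_smul_comm, sub_mul, mul_sub, h.aa, h.bb, h.ba]; module
    · simp only [hj, hm, smul_mul_smul_comm, sub_mul, mul_sub, add_mul, mul_add, h.aa, h.bb, h.ba]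
      module
  have hmj : ∀ z ∈ U, m z * j z = -n z := by
    intro z hz
    have h := hp.isImPair hU hz
    simp only [hm, hj, hn, smul_mul_smul_comm, add_mul, mul_sub, h.aa, h.bb, h.ba]; module
  have dd : ∀ z ∈ U, HasFDerivAt m (fderiv ℝ m z) z ∧ HasFDerivAt j (fderiv ℝ j z) z ∧
      HasFDerivAt n (fderiv ℝ n z) z ∧ ∀ h : ℂ, fderiv ℝ j z h = 0 ∧
        fderiv ℝ m z h = (-2 * (h.re - h.im)) • n z ∧
        fderiv ℝ n z h = (2 * (h.re - h.im)) • m z := by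
    intro z hz
    have d2 := (differentiableAt_of_contDiffOn hU (hp.contDiffOn_alpha2 hU) hz).hasFDerivAt
    have d3 := (differentiableAt_of_contDiffOn hU (hp.contDiffOn_alpha3 hU) hz).hasFDerivAt
    have dc := (differentiableAt_of_contDiffOn hU
      ((hp.contDiffOn_alpha2 hU).mul (hp.contDiffOn_alpha3 hU)) hz).hasFDerivAt
    have dm : HasFDerivAt m _ z := (d2.add d3).const_smul (1 / 2 : ℝ)
    have dj : HasFDerivAt j _ z := (d2.sub d3).const_smul (1 / 2 : ℝ)
    have dn : HasFDerivAt n _ z := dc.const_smul (1 / 2 : ℝ)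
    refine ⟨dm.differentiableAt.hasFDerivAt, dj.differentiableAt.hasFDerivAt,
      dn.differentiableAt.hasFDerivAt, fun h => ?_⟩
    rw [dm.fderiv, dj.fderiv, dn.fderiv]
    simp only [smul_apply, add_apply, sub_apply, fderiv_eq_du_dv _ z h]
    have e2 := hp.du_alpha2_mul_alpha3 hU hω hz
    have e3 := hp.dv_alpha2_mul_alpha3 hU hω hz
    rw [hp.du_alpha2 hU hω hz, hp.dv_alpha2 hU hω hz, hp.du_alpha3 hU hω hz,
      hp.dv_alpha3 hU hω hz, e2, e3, (hdω z hz).1, (hdω z hz).2, h0 z hz, Real.exp_zero]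
    simp only [hm, hn]
    refine ⟨?_, ?_, ?_⟩ <;> module
  -- match the frames at `z₀`
  obtain ⟨c, hc, hcm, hcj⟩ := exists_conj (hpair z₀ hz₀) (isImPair_conjI_qj (z₀.re - z₀.im))
  have hcs := mul_star_self_of_norm hc
  have hsc := star_mul_self_of_norm hc
  have hcancel : ∀ {x y : ℍ[ℝ]}, x - c * y * star c = 0 → x * c = c * y := by
    intro x y h
    rw [sub_eq_zero.1 h, mul_assoc, hsc, mul_one]
  have hcancel' : ∀ {x y : ℍ[ℝ]}, x * c = c * y → x - c * y * star c = 0 := by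
    intro x y h
    rw [← h, mul_assoc, hcs, mul_one, sub_self]
  have hφ : ∀ z, HasFDerivAt (fun z : ℂ => z.re - z.im) (Complex.reCLM - Complex.imCLM) z :=
    fun z => Complex.reCLM.hasFDerivAt.sub Complex.imCLM.hasFDerivAt
  have dK : ∀ z, HasFDerivAt (fun z : ℂ => conjI (z.re - z.im))
      ((Complex.reCLM - Complex.imCLM).smulRight ((2 : ℝ) • (conjI (z.re - z.im) * qj))) z := by
    intro z
    convert! (hasDerivAt_conjI (z.re - z.im)).hasFDerivAt.comp z (hφ z) using 1
  have hqj : qj * qj = -1 := by ext <;> simp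
  -- the deviations of the frame from the conjugated frame of the flat torus; they rotate into each
  -- other, so the sum of their squared lengths is constant
  set δm : ℂ → ℍ[ℝ] := fun z => m z - c * conjI (z.re - z.im) * star c with hδm
  set δn : ℂ → ℍ[ℝ] := fun z => n z - c * -(conjI (z.re - z.im) * qj) * star c with hδn
  have hδmd : ∀ z ∈ U, DifferentiableAt ℝ δm z ∧ DifferentiableAt ℝ δn z ∧ ∀ h : ℂ,
      fderiv ℝ δm z h = (-2 * (h.re - h.im)) • δn z ∧
      fderiv ℝ δn z h = (2 * (h.re - h.im)) • δm z := by
    intro z hz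
    obtain ⟨dm, -, dn, hd⟩ := dd z hz
    have k1 := ((dK z).const_mul c).mul_const' (star c)
    have k2 := ((((dK z).mul_const' qj).neg).const_mul c).mul_const' (star c)
    refine ⟨(dm.sub k1).differentiableAt, (dn.sub k2).differentiableAt, fun h => ⟨?_, ?_⟩⟩
    · refine (congrArg (fun T : ℂ →L[ℝ] ℍ[ℝ] => T h) (dm.sub k1).fderiv).trans ?_
      simp only [sub_apply, (hd h).2.1, hδn, smul_apply, ContinuousLinearMap.smulRight_apply,
        MulOpposite.smul_eq_mul_unop, MulOpposite.unop_op, Complex.reCLM_apply,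
        Complex.imCLM_apply, smul_eq_mul, mul_smul_comm, smul_mul_assoc, mul_neg, neg_mul]
      module
    · refine (congrArg (fun T : ℂ →L[ℝ] ℍ[ℝ] => T h) (dn.sub k2).fderiv).trans ?_
      simp only [sub_apply, (hd h).2.2, hδm, smul_apply, ContinuousLinearMap.smulRight_apply,
        MulOpposite.smul_eq_mul_unop, MulOpposite.unop_op, Complex.reCLM_apply,
        Complex.imCLM_apply, smul_eq_mul, mul_smul_comm, smul_mul_assoc, mul_neg, neg_mul,
        neg_apply, mul_assoc, hqj, mul_one]
      simp only [← mul_assoc, smul_neg]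
      module
  have hDconst : ∀ z ∈ U, inner ℝ (δm z) (δm z) + inner ℝ (δn z) (δn z) =
      inner ℝ (δm z₀) (δm z₀) + inner ℝ (δn z₀) (δn z₀) := by
    intro z hz
    refine hU.is_const_of_fderiv_eq_zero (𝕜 := ℝ)
      (f := fun z => inner ℝ (δm z) (δm z) + inner ℝ (δn z) (δn z)) hUc
      (fun w hw => ?_) (fun w hw => ?_) hz hz₀
    · obtain ⟨a1, a2, -⟩ := hδmd w hw
      exact ((a1.inner ℝ a1).add (a2.inner ℝ a2)).differentiableWithinAt
    · obtain ⟨a1, a2, a3⟩ := hδmd w hw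
      refine ContinuousLinearMap.ext fun h => ?_
      rw [fderiv_fun_add (a1.inner ℝ a1) (a2.inner ℝ a2), add_apply, fderiv_inner_apply ℝ a1 a1,
        fderiv_inner_apply ℝ a2 a2, (a3 h).1, (a3 h).2]
      simp only [real_inner_smul_left, real_inner_smul_right, real_inner_comm (δm w) (δn w),
        Pi.zero_apply, zero_apply]
      ring
  have hm0 : δm z₀ = 0 := hcancel' hcm
  have hn0 : δn z₀ = 0 := by
    refine hcancel' ?_
    have : n z₀ = -(m z₀ * j z₀) := by rw [hmj z₀ hz₀, neg_neg]
    rw [this, neg_mul, mul_assoc, hcj, ← mul_assoc, hcm, mul_assoc, mul_neg]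
  have hδ0 : ∀ z ∈ U, δm z = 0 ∧ δn z = 0 := by
    intro z hz
    have h := hDconst z hz
    rw [hm0, hn0, inner_zero_left, add_zero, real_inner_self_eq_norm_sq,
      real_inner_self_eq_norm_sq] at h
    constructor <;> rw [← norm_eq_zero] <;>
      nlinarith [sq_nonneg ‖δm z‖, sq_nonneg ‖δn z‖, norm_nonneg (δm z), norm_nonneg (δn z)]
  refine ⟨c, hc, fun z hz => ?_⟩
  have r1 : m z * c = c * conjI (z.re - z.im) := hcancel (hδ0 z hz).1
  have r2 : n z * c = c * -(conjI (z.re - z.im) * qj) := hcancel (hδ0 z hz).2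
  have r3 : j z * c = c * qj := by
    have : j z = j z₀ := hU.is_const_of_fderiv_eq_zero (𝕜 := ℝ) hUc
      (fun w hw => (dd w hw).2.1.differentiableAt.differentiableWithinAt)
      (fun w hw => ContinuousLinearMap.ext fun h => ((dd w hw).2.2.2 h).1) hz hz₀
    rw [this, hcj]
  have e1 : alpha2 p z = m z + j z := by simp only [hm, hj]; module
  have e2 : alpha3 p z = m z - j z := by simp only [hm, hj]; module
  have e3 : alpha2 p z * alpha3 p z = (2 : ℝ) • n z := by simp only [hn]; module
  refine ⟨?_, ?_, ?_⟩
  · rw [e1, add_mul, r1, r3, mul_add]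
  · rw [e2, sub_mul, r1, r3, mul_sub]
  · rw [e3, smul_mul_assoc, r2, mul_neg, smul_neg]

/-- For `ω = 0`, the immersion is congruent to the flat torus: the one-forms `p⁻¹ dp` and `q⁻¹ dq`
are conjugate, by one and the same constant, to those of the flat torus. -/
theorem eq_flatTorus (hUsc : IsSimplyConnected U) (hω : ContDiffOn ℝ (⊤ : ℕ∞) ω U)
    (h0 : ∀ z ∈ U, ω z = 0) {q : ℂ × ℝ → ℍ[ℝ]} (hq : IsSecondComponent U ω p q) :
    ∃ a b c : ℍ[ℝ], ‖a‖ = 1 ∧ ‖b‖ = 1 ∧ ‖c‖ = 1 ∧ ∀ z ∈ U, ∀ t : ℝ, (p z, q (z, t)) =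
      isometry a b c (flatTorus (z.re - z.im) (-(√3 / 2) * t) (z.re + z.im)) := by
  have hUc := hUsc.isPathConnected.isConnected.isPreconnected
  have hq' := (hp.isSecondComponent_iff hU hω).1 hq
  obtain ⟨z₀, hz₀⟩ := hUsc.nonempty
  obtain ⟨c, hc, hfr⟩ := hp.exists_conj_frame hU hUc hω h0 hz₀
  have hqjs : star qj = -qj := by ext <;> simp
  obtain ⟨a, ha, hpa⟩ := exists_eq_mul_mul_inv hU hUc ⟨z₀, hz₀⟩
    (A := fun z => oneForm (alpha2 p z) (alpha3 p z))
    (B := fun z => oneForm (conjI (z.re - z.im) + qj) (conjI (z.re - z.im) - qj))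
    (F := p) (G := fun z => rotI (z.re + z.im) * rotJ (z.re - z.im))
    (fun z hz => by
      convert! (differentiableAt_of_contDiffOn hU hp.smooth hz).hasFDerivAt using 1
      exact ContinuousLinearMap.ext fun h => (hp.fderiv_eq_mul_oneForm hz h).symm)
    (fun z hz => hasFDerivAt_rotI_mul_rotJ (V := fun z : ℂ => z.re + z.im)
      (W := fun z : ℂ => z.re - z.im) (Complex.reCLM.hasFDerivAt.add Complex.imCLM.hasFDerivAt)
      (Complex.reCLM.hasFDerivAt.sub Complex.imCLM.hasFDerivAt) fun h => by
        simp only [oneForm_apply, add_apply, sub_apply, Complex.reCLM_apply, Complex.imCLM_apply]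
        module)
    hp.mem_sphere (fun z hz => by rw [norm_mul, norm_rotI, norm_rotJ, one_mul])
    (fun z hz h => by
      simp only [oneForm_apply, star_add, star_sub, star_smul, star_trivial, star_conjI, hqjs]
      module)
    hc (fun z hz h => by
      simp only [oneForm_apply, add_mul, smul_mul_assoc, (hfr z hz).1, (hfr z hz).2.1, mul_add,
        mul_smul_comm])
  obtain ⟨b, hb, hqb⟩ := exists_eq_mul_mul_inv (s := U ×ˢ univ) (hU.prod isOpen_univ)
    (hUc.prod isPreconnected_univ) ⟨(z₀, 0), hz₀, trivial⟩
    (A := secondForm ω p)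
    (B := fun x => threeForm qj (-qj) (-(√3 / 2) • conjI (x.1.re - x.1.im - Real.pi / 4)))
    (F := q) (G := fun x => rotI (-(√3 / 2) * x.2) * rotJ (x.1.re - x.1.im - Real.pi / 4))
    (fun x hx => (hq' x hx).2)
    (fun x hx => hasFDerivAt_rotI_mul_rotJ (V := fun x : ℂ × ℝ => -(√3 / 2) * x.2)
      (W := fun x : ℂ × ℝ => x.1.re - x.1.im - Real.pi / 4)
      (V' := (-(√3 / 2)) • ContinuousLinearMap.snd ℝ ℂ ℝ)
      (W' := (Complex.reCLM - Complex.imCLM).comp (ContinuousLinearMap.fst ℝ ℂ ℝ))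
      (hasFDerivAt_snd.const_mul _)
      (((Complex.reCLM - Complex.imCLM).comp
        (ContinuousLinearMap.fst ℝ ℂ ℝ)).hasFDerivAt.sub_const (Real.pi / 4)) fun h => by
        simp only [threeForm_apply, smul_apply, ContinuousLinearMap.comp_apply, sub_apply,
          Complex.reCLM_apply, Complex.imCLM_apply, ContinuousLinearMap.coe_fst',
          ContinuousLinearMap.coe_snd', smul_eq_mul]
        module)
    (fun x hx => (hq' x hx).1) (fun x hx => by rw [norm_mul, norm_rotI, norm_rotJ, one_mul])
    (fun x hx h => by
      simp only [threeForm_apply, star_add, star_smul, star_trivial, star_conjI, star_neg, hqjs]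
      module)
    hc (fun x hx h => by
      obtain ⟨f1, f2, f3⟩ := hfr x.1 hx.1
      simp only [secondForm, threeForm_apply, secondU, secondV, leftNormal, h0 x.1 hx.1, mul_zero,
        Real.exp_zero, add_mul, sub_mul, smul_mul_assoc, f1, f2, f3, conjI_sub_pi_div_four,
        mul_add, mul_sub, mul_smul_comm, mul_neg]
      have : du ω x.1 = 0 ∧ dv ω x.1 = 0 := by
        have : ω =ᶠ[𝓝 x.1] fun _ => 0 := by
          filter_upwards [hU.mem_nhds hx.1] with w hw using h0 w hw
        simp [du, dv, this.fderiv_eq]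
      rw [this.1, this.2]
      module)
  refine ⟨a, b, c, ha, hb, hc, fun z hz t => ?_⟩
  unfold isometry flatTorus
  rw [flatTorusP_eq, flatTorusQ_eq, hpa z hz, hqb (z, t) ⟨hz, trivial⟩]

end IsAssociatedMinimalSurface

end NKS3

end

theorem theoremt3 (U : Set ℂ) (hU : IsOpen U) (hUsc : IsSimplyConnected U) (ω : ℂ → ℝ)
    (hω : NKS3.IsSinhGordonSolution U ω) :
    (∃ p : ℂ → ℍ[ℝ], NKS3.IsAssociatedMinimalSurface U ω p) ∧
    ∀ p : ℂ → ℍ[ℝ], NKS3.IsAssociatedMinimalSurface U ω p →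
      (∀ z₀ ∈ U, ∀ (t₀ : ℝ) (q₀ : ℍ[ℝ]), ‖q₀‖ = 1 →
        ∃ q : ℂ × ℝ → ℍ[ℝ], NKS3.IsSecondComponent U ω p q ∧ q (z₀, t₀) = q₀ ∧
          ∀ q' : ℂ × ℝ → ℍ[ℝ], NKS3.IsSecondComponent U ω p q' → q' (z₀, t₀) = q₀ →
            Set.EqOn q' q (U ×ˢ Set.univ)) ∧
      (∀ q : ℂ × ℝ → ℍ[ℝ], NKS3.IsSecondComponent U ω p q →
        NKS3.IsLagrangianImmersion (U ×ˢ Set.univ) (fun x => (p x.1, q x))) ∧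
      ((∀ z ∈ U, ω z = 0) → ∀ q : ℂ × ℝ → ℍ[ℝ], NKS3.IsSecondComponent U ω p q →
        ∃ a b c : ℍ[ℝ], ‖a‖ = 1 ∧ ‖b‖ = 1 ∧ ‖c‖ = 1 ∧
          ∀ z ∈ U, ∀ t : ℝ, (p z, q (z, t)) =
            NKS3.isometry a b c
              (NKS3.flatTorus (z.re - z.im) (-(√3 / 2) * t) (z.re + z.im))) := by
  refine ⟨NKS3.exists_isAssociatedMinimalSurface hU hUsc hω, fun p hp =>
    ⟨fun z₀ hz₀ t₀ q₀ hq₀ => ?_, fun q hq => hp.isLagrangianImmersion hU hω.1 hq,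
      fun h0 q hq => hp.eq_flatTorus hU hUsc hω.1 h0 hq⟩⟩
  obtain ⟨q, hq, hq0⟩ := hp.exists_isSecondComponent hU hUsc hω hz₀ t₀ hq₀
  exact ⟨q, hq, hq0, fun q' hq' h =>
    hp.eqOn_of_isSecondComponent hU hUsc hω.1 hq hq' hz₀ (h.trans hq0.symm)⟩
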